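/- Let $k\ge 3$ and let $c_1,\dots,c_k\in\mathbb C\setminus\{0,1,-1\}$. Let $C_i\subset SL_2(\mathbb C)$ be the conjugacy class of matrices with eigenvalues $c_i,c_i^{-1}$. Assume that $C_1,\dots,C_k$ are \emph{very generic}: for every $1\le i\le k$ and all signs $\epsilon_j\in\{1,-1\}$, neither $\prod_{j\le i}c_j^{\epsilon_j}$ nor $\prod_{j\ge i}c_j^{\epsilon_j}$ is equal to $1$ or $-1$. Let $S$ be the $2$-sphere with $k$ open disks removed, with boundary circles $\xi_1,\dots,\xi_k$, and let $$M(S,C_\cdot)=\{(A_1,\dots,A_k)\,:\,A_i\in C_i,\ A_1\cdots A_k=1\}/PGL_2(\mathbb C)$$ be the moduli variety of rank $2$ local systems on $S$ with monodromy around $\xi_i$ in $C_i$. Cut $S$ along circles $\rho_2,\dots,\rho_{k-2}$ into pairs of pants $S_2,\dots,S_{k-1}$, where $\rho_i$ separates $\xi_1,\dots,\xi_i$ from $\xi_{i+1},\dots,\xi_k$, so that the monodromy around $\rho_i$ is $A_1\cdots A_i$, and $V|_{S_i}$ is given by the pair $(A_1\cdots A_{i-1},A_i)$. Say that $V|_{S_i}$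 is \emph{unstable} if it has a rank $1$ subsystem on which the monodromy around $\xi_i$ is $c_i^{-1}$, and \emph{stable} otherwise. For a datum $\alpha=(\sigma_2,\dots,\sigma_{k-1};G_2,\dots,G_{k-2})$, with nonempty $\sigma_i\subset\{0,1\}$ and conjugacy-invariant $G_i\subset SL_2(\mathbb C)$, let $M^\alpha(S,C_\cdot)\subset M(S,C_\cdot)$ be the locus of local systems $V$ such that $V|_{S_i}$ is unstable if $\sigma_i=\{0\}$ and stable if $\sigma_i=\{1\}$ (no condition if $\sigma_i=\{0,1\}$), and such that the monodromy around each $\rho_i$ lies in $G_i$. Let $M'=M^{\alpha'}(S,C_\cdot)$, where $\alpha'$ has all $\sigma_i=\{1\}$ and all $G_i$ equal to the set of matrices of trace different from $2$ and $-2$. Then there exists a finite collection of data $\alpha^j$ such that $$M(S,C_\cdot)=M'\sqcup\coprod_j M^{\alpha^j}(S,C_\cdot)$$ is a stratification with open stratum $M'$: a decomposition into disjoint (Zariski) locally closed subsets, with $M'$ open, such that for some total order on the indices $j$ every union $\bigcup_{j\le a}M^{\alpha^j}(S,C_\cdot)$ is closed. Furthermore, it admits a refinement, which is a stratification in the same sense,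 consisting of $M'$ together with finitely many locally closed pieces $Z^{j,a}\subset M^{\alpha^j}(S,C_\cdot)$ such that each $Z^{j,a}$, with its reduced structure, is isomorphic as a variety to $Y^{j,a}\times\mathbb A^1$ for some variety $Y^{j,a}$. -/

import Mathlib

open scoped Topology

/-! ### Complex varieties as spaces with functions -/

/-- A sheaf of complex-valued functions on a topological space, recorded through its germs:
`RegularAt f x` says that `f` is regular in some open neighbourhood of `x` (the values of `f` far
from `x` are irrelevant). -/
class RegularFunctions (X : Type*) [TopologicalSpace X] where
  RegularAt : (X → ℂ) → X → Prop
  congr : ∀ {f g : X → ℂ} {x : X}, f =ᶠ[𝓝 x] g → RegularAt f x → RegularAt g x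
  eventually : ∀ {f : X → ℂ} {x : X}, RegularAt f x → ∀ᶠ y in 𝓝 x, RegularAt f y

open RegularFunctions (RegularAt)

/-- A morphism: a continuous map that pulls regular functions back to regular functions. -/
def IsMorphism {X Y : Type*} [TopologicalSpace X] [RegularFunctions X] [TopologicalSpace Y]
    [RegularFunctions Y] (φ : X → Y) : Prop :=
  Continuous φ ∧ ∀ (x : X) (g : Y → ℂ), RegularAt g (φ x) → RegularAt (g ∘ φ) x

/-- Two spaces with functions are isomorphic. -/
def AreIsomorphic (X Y : Type*) [TopologicalSpace X] [RegularFunctions X] [TopologicalSpace Y]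
    [RegularFunctions Y] : Prop :=
  ∃ e : X ≃ Y, IsMorphism e ∧ IsMorphism e.symm

/-- The structure induced along a continuous map `j` (in practice an inclusion): a function is
regular when it is locally the restriction of a regular function. -/
@[reducible]
def RegularFunctions.induced {S X : Type*} [TopologicalSpace S] [TopologicalSpace X]
    [RegularFunctions X] (j : S → X) (hj : Continuous j) : RegularFunctions S where
  RegularAt f s := ∃ F : X → ℂ, RegularAt F (j s) ∧ f =ᶠ[𝓝 s] F ∘ j
  congr := by
    rintro f g s hfg ⟨F, hF, hf⟩
    exact ⟨F, hF, hfg.symm.trans hf⟩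
  eventually := by
    rintro f s ⟨F, hF, hf⟩
    filter_upwards [hj.continuousAt.eventually (RegularFunctions.eventually hF),
      hf.eventually_nhds] with y h1 h2
    exact ⟨F, h1, h2⟩

/-- The structure of a quotient `q : X → Q`: a function is regular near a point of `Q` when its
pullback to `X` is regular on the preimage of a neighbourhood of that point. -/
@[reducible]
def RegularFunctions.coinduced {X Q : Type*} [TopologicalSpace X] [RegularFunctions X]
    [TopologicalSpace Q] (q : X → Q) (hq : Continuous q) : RegularFunctions Q where
  RegularAt f m := ∀ᶠ m' in 𝓝 m, ∀ x : X, q x = m' → RegularAt (f ∘ q) x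
  congr := by
    intro f g m hfg hf
    filter_upwards [hfg.eventually_nhds, hf] with m' h1 h2 x hx
    subst hx
    exact RegularFunctions.congr (hq.continuousAt.eventually h1) (h2 x rfl)
  eventually := by
    intro f m hf
    exact hf.eventually_nhds

/-- Locally closed (or arbitrary) subsets carry the reduced induced structure. -/
instance {X : Type*} [TopologicalSpace X] [RegularFunctions X] (Z : Set X) :
    RegularFunctions Z :=
  RegularFunctions.induced Subtype.val continuous_subtype_val

/-- The complex affine space with coordinates indexed by `ι`. -/
structure ComplexAffineSpace (ι : Type) where
  coord : ι → ℂ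

/-- The Zariski topology, with basis the sets where a polynomial does not vanish. -/
instance (ι : Type) : TopologicalSpace (ComplexAffineSpace ι) :=
  TopologicalSpace.generateFrom
    (Set.range fun p : MvPolynomial ι ℂ => {x | MvPolynomial.eval x.coord p ≠ 0})

/-- Regular functions on affine space are locally quotients of polynomials. -/
instance (ι : Type) : RegularFunctions (ComplexAffineSpace ι) where
  RegularAt f x := ∃ p q : MvPolynomial ι ℂ, MvPolynomial.eval x.coord q ≠ 0 ∧
    ∀ᶠ y in 𝓝 x, f y = MvPolynomial.eval y.coord p / MvPolynomial.eval y.coord q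
  congr := by
    rintro f g x hfg ⟨p, q, hq, h⟩
    refine ⟨p, q, hq, ?_⟩
    filter_upwards [hfg, h] with y h1 h2
    rw [← h1, h2]
  eventually := by
    rintro f x ⟨p, q, hq, h⟩
    have ho : IsOpen {y : ComplexAffineSpace ι | MvPolynomial.eval y.coord q ≠ 0} :=
      TopologicalSpace.isOpen_generateFrom_of_mem ⟨q, rfl⟩
    filter_upwards [ho.mem_nhds hq, h.eventually_nhds] with y h1 h2
    exact ⟨p, q, h1, h2⟩

/-- The product `Y × 𝔸¹` of a subset `Y` of affine `m`-space with the affine line, inside affine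
`(m + 1)`-space; the last coordinate is the one of `𝔸¹`. -/
def timesAffineLine {m : ℕ} (Y : Set (ComplexAffineSpace (Fin m))) :
    Set (ComplexAffineSpace (Fin (m + 1))) :=
  {x | (⟨fun i => x.coord i.castSucc⟩ : ComplexAffineSpace (Fin m)) ∈ Y}

/-- `Z` has the form `Y × 𝔸¹` for a variety `Y`. Here `Y` is taken to be quasi-affine, which loses
nothing for a subset `Z` of an affine variety, as `Y ≅ Y × {0}` is then closed in `Z`. -/
def IsProductWithAffineLine {X : Type*} [TopologicalSpace X] [RegularFunctions X]
    (Z : Set X) : Prop :=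
  ∃ (m : ℕ) (Y : Set (ComplexAffineSpace (Fin m))),
    IsLocallyClosed Y ∧ AreIsomorphic Z (timesAffineLine Y)

/-- `X = U ⊔ Z₀ ⊔ ⋯ ⊔ Z_{N-1}` is a totally ordered stratification with open stratum `U`: a
decomposition into disjoint locally closed subsets such that `⋃_{j ≤ a} Z_j` is closed for all
`a`. -/
def IsOrderedStratification {X : Type*} [TopologicalSpace X] (U : Set X) {N : ℕ}
    (Z : Fin N → Set X) : Prop :=
  IsOpen U ∧ (∀ j, IsLocallyClosed (Z j)) ∧
  (∀ j, Disjoint U (Z j)) ∧ Pairwise (fun i j => Disjoint (Z i) (Z j)) ∧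
  U ∪ (⋃ j, Z j) = Set.univ ∧
  ∀ a, IsClosed (⋃ j ≤ a, Z j)

/-! ### Rank two local systems on the sphere with `k = n + 3` holes -/

/-- The group `SL₂(ℂ)`. -/
abbrev SL2 : Type := Matrix.SpecialLinearGroup (Fin 2) ℂ

/-- The conjugacy class of matrices with eigenvalues `c, c⁻¹` (for `c ≠ 0, 1, -1`). -/
def eigenClass (c : ℂ) : Set SL2 :=
  {A | ∃ P : GL (Fin 2) ℂ,
    (A : Matrix (Fin 2) (Fin 2) ℂ) = P.val * Matrix.diagonal ![c, c⁻¹] * P⁻¹.val}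

section LocalSystems

variable {n : ℕ}

/-- Framed local systems on the sphere with `n + 3` holes: sequences `A₁, …, A_k` (here indexed
from `0`) with `A_i` in the conjugacy class `C_i` and `A₁ ⋯ A_k = 1`. -/
structure FramedLocalSystem (c : Fin (n + 3) → ℂ) where
  mat : Fin (n + 3) → SL2
  mem_class : ∀ i, mat i ∈ eigenClass (c i)
  prod_eq_one : (List.ofFn mat).prod = 1

namespace FramedLocalSystem

variable {c : Fin (n + 3) → ℂ}

/-- The matrix entries, which embed the framed local systems in affine space. -/
def entries (A : FramedLocalSystem c) :
    ComplexAffineSpace (Fin (n + 3) × Fin 2 × Fin 2) :=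
  ⟨fun i => (A.mat i.1 : Matrix (Fin 2) (Fin 2) ℂ) i.2.1 i.2.2⟩

instance : TopologicalSpace (FramedLocalSystem c) :=
  TopologicalSpace.induced entries inferInstance

instance : RegularFunctions (FramedLocalSystem c) :=
  RegularFunctions.induced entries continuous_induced_dom

/-- The product `A₁ ⋯ A_j` of the first `j` matrices. For `2 ≤ j ≤ k - 2` this is the monodromy
around the circle `ρ_j` that separates the holes `1, …, j` from the others. -/
def partialProd (A : FramedLocalSystem c) (j : ℕ) : SL2 :=
  ((List.ofFn A.mat).take j).prod

/-- Instability on the `p`-th pair of pants. The index `p : Fin (n + 1)` stands for `S_i` with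
`i = p + 2`, whose fundamental group is generated by the loop of monodromy `A₁ ⋯ A_{i-1}` around
`ρ_{i-1}` and the loop of monodromy `A_i` around the hole `ξ_i`: there is a line, stable under
both, on which `A_i` acts by `c_i⁻¹`. -/
def IsUnstable (A : FramedLocalSystem c) (p : Fin (n + 1)) : Prop :=
  ∃ v : Fin 2 → ℂ, v ≠ 0 ∧
    (∃ b : ℂ, (A.partialProd (p + 1) : Matrix (Fin 2) (Fin 2) ℂ).mulVec v = b • v) ∧
    (A.mat p.succ.castSucc : Matrix (Fin 2) (Fin 2) ℂ).mulVec v = (c p.succ.castSucc)⁻¹ • v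

/-- Stability on the `p`-th pair of pants. -/
def IsStable (A : FramedLocalSystem c) (p : Fin (n + 1)) : Prop := ¬ A.IsUnstable p

/-- Simultaneous conjugation by `GL₂(ℂ)`, which is the action of `PGL₂(ℂ)`. -/
def conjSetoid (c : Fin (n + 3) → ℂ) : Setoid (FramedLocalSystem c) where
  r A B := ∃ P : GL (Fin 2) ℂ, ∀ i,
    (B.mat i : Matrix (Fin 2) (Fin 2) ℂ) = P.val * (A.mat i).val * P⁻¹.val
  iseqv :=
    { refl := fun A => ⟨1, fun i => by simp⟩
      symm := by
        rintro A B ⟨P, h⟩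
        refine ⟨P⁻¹, fun i => ?_⟩
        rw [h i]
        simp [mul_assoc]
      trans := by
        rintro A B D ⟨P, h⟩ ⟨Q, h'⟩
        refine ⟨Q * P, fun i => ?_⟩
        rw [h' i, h i]
        simp [mul_assoc] }

end FramedLocalSystem

/-- The moduli space `M(S, C_·)` of local systems with monodromy in `C_i` around the `i`-th hole:
the quotient of the framed local systems by `PGL₂`. -/
def ModuliSpace (c : Fin (n + 3) → ℂ) : Type := Quotient (FramedLocalSystem.conjSetoid c)

namespace ModuliSpace

/-- The isomorphism class of a framed local system. -/
def mk {c : Fin (n + 3) → ℂ} (A : FramedLocalSystem c) : ModuliSpace c :=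
  Quotient.mk (FramedLocalSystem.conjSetoid c) A

/-- The quotient of the Zariski topology. -/
instance (c : Fin (n + 3) → ℂ) : TopologicalSpace (ModuliSpace c) :=
  TopologicalSpace.coinduced mk inferInstance

/-- Regular functions on the moduli space are the `PGL₂`-invariant regular functions of framed
local systems. -/
instance (c : Fin (n + 3) → ℂ) : RegularFunctions (ModuliSpace c) :=
  RegularFunctions.coinduced mk continuous_coinduced_rng

end ModuliSpace

/-- A datum `α = (σ₂, …, σ_{k-1}; G₂, …, G_{k-2})` of nonempty subsets `σ_i ⊂ {0, 1}` and
conjugacy-invariant subsets `G_i ⊂ SL₂(ℂ)`. The index `p : Fin (n + 1)` stands for `i = p + 2` in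
the first list, and so does `q : Fin n` in the second. -/
structure StratumDatum (n : ℕ) where
  σ : Fin (n + 1) → Set (Fin 2)
  σ_nonempty : ∀ p, (σ p).Nonempty
  G : Fin n → Set SL2
  G_conj : ∀ q A B, IsConj A B → A ∈ G q → B ∈ G q

/-- The locus `M^α(S, C_·)`: local systems that are unstable on `S_i` if `σ_i = {0}`, stable on
`S_i` if `σ_i = {1}`, and whose monodromy around `ρ_i` lies in `G_i`. -/
def StratumDatum.stratum (α : StratumDatum n) (c : Fin (n + 3) → ℂ) : Set (ModuliSpace c) :=
  ModuliSpace.mk '' {A | (∀ p, (α.σ p = {0} → A.IsUnstable p) ∧ (α.σ p = {1} → A.IsStable p)) ∧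
    ∀ q : Fin n, A.partialProd (q + 2) ∈ α.G q}

/-- The matrices of trace different from `2` and `-2`. -/
def traceNeTwo : Set SL2 :=
  {A | Matrix.trace A.val ≠ 2 ∧ Matrix.trace A.val ≠ -2}

/-- The datum `α'`: stable on all pairs of pants, all traces different from `2` and `-2`. -/
def mainDatum (n : ℕ) : StratumDatum n where
  σ _ := {1}
  σ_nonempty _ := Set.singleton_nonempty 1
  G _ := traceNeTwo
  G_conj := by
    intro _ A B hAB hA
    obtain ⟨P, rfl⟩ := isConj_iff.mp hAB
    have h : Matrix.trace (P * A * P⁻¹ : SL2).val = Matrix.trace A.val := by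
      have e : P⁻¹ * (P * A) = A := by simp
      rw [Matrix.SpecialLinearGroup.coe_mul, Matrix.trace_mul_comm,
        ← Matrix.SpecialLinearGroup.coe_mul, e]
    exact ⟨h ▸ hA.1, h ▸ hA.2⟩

/-- The locus `M' = M^{α'}(S, C_·)`. -/
def mainStratum (c : Fin (n + 3) → ℂ) : Set (ModuliSpace c) := (mainDatum n).stratum c

/-- The sequence of conjugacy classes is very generic: for every `i`, no product of eigenvalues,
one for each of `C₁, …, C_i` or one for each of `C_i, …, C_k`, is equal to `1` or `-1`. -/
def VeryGeneric (c : Fin (n + 3) → ℂ) : Prop :=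
  ∀ (ε : Fin (n + 3) → ℤˣ) (i : Fin (n + 3)),
    ((∏ j ∈ Finset.Iic i, c j ^ (ε j : ℤ)) ≠ 1 ∧ (∏ j ∈ Finset.Iic i, c j ^ (ε j : ℤ)) ≠ -1) ∧
    ((∏ j ∈ Finset.Ici i, c j ^ (ε j : ℤ)) ≠ 1 ∧ (∏ j ∈ Finset.Ici i, c j ^ (ε j : ℤ)) ≠ -1)

end LocalSystems

/-!
Write `B_i = A₁ ⋯ A_i` for the monodromy around `ρ_i`. The conditions "`tr B_i = ±2`", for the
successive `ρ_i`, followed by "`V` is unstable on `S_i`", for the successive pairs of pants, define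
closed subsets of the moduli space. Recording the first of these conditions that a local system
satisfies decomposes the moduli space into `M'`, where none is satisfied, and the loci of data
`firstBadDatum`, in an order for which the initial unions are closed
(`isOrderedStratification_of_closed`, `mem_stratum_firstBadDatum`).

For the refinement, each stratum singles out a line `ℓ`, the `μ`-eigenline of a nonscalar matrix
`T ∈ SL₂` that is a word in the `A_l`:
* if `B_i ≠ ±1` has trace `±2`, then `T = B_i` and `ℓ` is its unique eigenline;
* if `B_i = ±1`, then `T = A₁` and `ℓ` is one of its eigenlines;
* if `V` is unstable on `S_i`, then `T = A_i` and `ℓ` is the destabilizing line.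

That a matrix `X` preserves `ℓ` is the closed condition `(T - μ) X (T - μ⁻¹) = 0` (`lineDefect`).
Very genericity implies that some `A_m` does not preserve `ℓ`, and in the first two cases that such
an `A_m` exists both among `A₁, …, A_i` and among `A_{i+1}, …, A_k`
(`VeryGeneric.exists_not_eigenvector_left` and its variants). The stratum is refined according to
the first such indices. On a piece `Z` where `A_m` does not preserve `ℓ`, there is a unique frame
`(e₁, e₂)`, up to a scalar, with `e₁ ∈ ℓ` and `e₂ = A_m e₁`; so `Z` is identified with the set
`normalizedSlice` of tuples for which this frame is the standard one. The identification is an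
isomorphism because the entries in this frame are quotients of traces of words
(`exists_regular_entry`).

Conjugating the `A_l` by unipotent matrices that fix `ℓ`, with speeds depending on `l`, gives a flow
on the slice. If `tr B_i = ±2`, then `B_i` commutes with these matrices and the flow conjugates
`A_{i+1}, …, A_k` only (`isProductWithAffineLine_of_eigenline_left`). If `V` is unstable on `S_i`,
the flow moves the extension class of `V` on `S_i`: it conjugates `A_i` with speed `1` and the
matrices on the side of `A_i` that does not contain `A_m` with the speed that restores the relation
`A₁ ⋯ A_k = 1`; that speed exists because the eigenvalues of `B_{i-1}`, respectively `B_i`, are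
distinct (`isProductWithAffineLine_of_unstable`). In both cases there is a regular function on the
slice that increases at unit speed along the flow, so that the slice is the product of the zero set
of this function and the affine line (`isProductWithAffineLine_of_flow`).
-/

/-! ### Calculus of regular functions -/

/-- The regular functions form a sheaf of rings whose stalks are local with residue field `ℂ`:
a regular function that does not vanish at a point does not vanish nearby, and is invertible. -/
class HasRegularCalculus (X : Type*) [TopologicalSpace X] [RegularFunctions X] : Prop where
  const : ∀ (a : ℂ) (x : X), RegularAt (fun _ => a) x
  add : ∀ {f g : X → ℂ} {x : X}, RegularAt f x → RegularAt g x → RegularAt (fun y => f y + g y) x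
  mul : ∀ {f g : X → ℂ} {x : X}, RegularAt f x → RegularAt g x → RegularAt (fun y => f y * g y) x
  inv : ∀ {f : X → ℂ} {x : X}, RegularAt f x → f x ≠ 0 → RegularAt (fun y => (f y)⁻¹) x
  eventually_ne : ∀ {f : X → ℂ} {x : X}, RegularAt f x → f x ≠ 0 → ∀ᶠ y in 𝓝 x, f y ≠ 0

namespace RegularFunctions

section Calculus

variable {X : Type*} [TopologicalSpace X] [RegularFunctions X] [HasRegularCalculus X]
  {f g : X → ℂ} {x : X}

theorem RegularAt.const (a : ℂ) (x : X) : RegularAt (fun _ => a) x :=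
  HasRegularCalculus.const a x

theorem RegularAt.add (hf : RegularAt f x) (hg : RegularAt g x) :
    RegularAt (fun y => f y + g y) x :=
  HasRegularCalculus.add hf hg

theorem RegularAt.mul (hf : RegularAt f x) (hg : RegularAt g x) :
    RegularAt (fun y => f y * g y) x :=
  HasRegularCalculus.mul hf hg

theorem RegularAt.inv (hf : RegularAt f x) (h : f x ≠ 0) : RegularAt (fun y => (f y)⁻¹) x :=
  HasRegularCalculus.inv hf h

theorem RegularAt.eventually_ne (hf : RegularAt f x) (h : f x ≠ 0) : ∀ᶠ y in 𝓝 x, f y ≠ 0 :=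
  HasRegularCalculus.eventually_ne hf h

theorem RegularAt.neg (hf : RegularAt f x) : RegularAt (fun y => -f y) x := by
  simpa using (RegularAt.const (-1) x).mul hf

theorem RegularAt.sub (hf : RegularAt f x) (hg : RegularAt g x) :
    RegularAt (fun y => f y - g y) x := by
  simpa [sub_eq_add_neg] using hf.add hg.neg

theorem RegularAt.div (hf : RegularAt f x) (hg : RegularAt g x) (h : g x ≠ 0) :
    RegularAt (fun y => f y / g y) x := by
  simpa [div_eq_mul_inv] using hf.mul (hg.inv h)

theorem RegularAt.mvPolynomial {ι : Type*} {φ : X → ι → ℂ}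
    (hφ : ∀ i, RegularAt (fun y => φ y i) x) (p : MvPolynomial ι ℂ) :
    RegularAt (fun y => MvPolynomial.eval (φ y) p) x := by
  induction p using MvPolynomial.induction_on with
  | C a => simpa using RegularAt.const a x
  | add p q hp hq => simpa using hp.add hq
  | mul_X p i hp => simpa using hp.mul (hφ i)

theorem isClosed_setOf_eq_zero (hf : ∀ x, RegularAt f x) : IsClosed {x | f x = 0} := by
  rw [← isOpen_compl_iff, isOpen_iff_mem_nhds]
  intro x hx
  exact (hf x).eventually_ne hx

theorem isClosed_setOf_eq (hf : ∀ x, RegularAt f x) (a : ℂ) : IsClosed {x | f x = a} := by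
  simpa [sub_eq_zero] using isClosed_setOf_eq_zero fun x => (hf x).sub (RegularAt.const a x)

end Calculus

theorem _root_.ComplexAffineSpace.isOpen_eval_ne_zero {ι : Type} (p : MvPolynomial ι ℂ) :
    IsOpen {x : ComplexAffineSpace ι | MvPolynomial.eval x.coord p ≠ 0} :=
  TopologicalSpace.isOpen_generateFrom_of_mem ⟨p, rfl⟩

instance (ι : Type) : HasRegularCalculus (ComplexAffineSpace ι) where
  const a x := ⟨MvPolynomial.C a, 1, by simp, by simp⟩
  add := by
    rintro f g x ⟨p, q, hq, hf⟩ ⟨p', q', hq', hg⟩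
    refine ⟨p * q' + p' * q, q * q', by simp [hq, hq'], ?_⟩
    filter_upwards [hf, hg, (ComplexAffineSpace.isOpen_eval_ne_zero q).mem_nhds hq,
      (ComplexAffineSpace.isOpen_eval_ne_zero q').mem_nhds hq'] with y h1 h2 h3 h4
    replace h3 : MvPolynomial.eval y.coord q ≠ 0 := h3
    replace h4 : MvPolynomial.eval y.coord q' ≠ 0 := h4
    rw [h1, h2]
    simp only [map_add, map_mul]
    field_simp
  mul := by
    rintro f g x ⟨p, q, hq, hf⟩ ⟨p', q', hq', hg⟩
    refine ⟨p * p', q * q', by simp [hq, hq'], ?_⟩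
    filter_upwards [hf, hg] with y h1 h2
    rw [h1, h2]
    simp only [map_mul, mul_div_mul_comm]
  inv := by
    rintro f x ⟨p, q, hq, hf⟩ h
    refine ⟨q, p, ?_, ?_⟩
    · intro hp
      exact h (by rw [hf.self_of_nhds, hp, zero_div])
    · filter_upwards [hf] with y h1
      rw [h1, inv_div]
  eventually_ne := by
    rintro f x ⟨p, q, hq, hf⟩ h
    have hp : MvPolynomial.eval x.coord p ≠ 0 := by
      intro hp
      exact h (by rw [hf.self_of_nhds, hp, zero_div])
    filter_upwards [hf, (ComplexAffineSpace.isOpen_eval_ne_zero q).mem_nhds hq,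
      (ComplexAffineSpace.isOpen_eval_ne_zero p).mem_nhds hp] with y h1 h2 h3
    rw [h1]
    exact div_ne_zero h3 h2

theorem _root_.HasRegularCalculus.induced {S X : Type*} [TopologicalSpace S] [TopologicalSpace X]
    [RegularFunctions X] [HasRegularCalculus X] (j : S → X) (hj : Continuous j) :
    @HasRegularCalculus S _ (RegularFunctions.induced j hj) :=
  letI := RegularFunctions.induced j hj
  { const := fun a s => ⟨fun _ => a, RegularAt.const a _, Filter.Eventually.of_forall fun _ => rfl⟩
    add := by
      rintro f g s ⟨F, hF, hf⟩ ⟨G, hG, hg⟩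
      refine ⟨_, hF.add hG, ?_⟩
      filter_upwards [hf, hg] with y h1 h2
      simp [h1, h2]
    mul := by
      rintro f g s ⟨F, hF, hf⟩ ⟨G, hG, hg⟩
      refine ⟨_, hF.mul hG, ?_⟩
      filter_upwards [hf, hg] with y h1 h2
      simp [h1, h2]
    inv := by
      rintro f s ⟨F, hF, hf⟩ h
      have h0 : F (j s) ≠ 0 := fun h1 => h (hf.self_of_nhds.trans h1)
      refine ⟨_, hF.inv h0, ?_⟩
      filter_upwards [hf] with y h1
      simp [h1]
    eventually_ne := by
      rintro f s ⟨F, hF, hf⟩ h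
      have h0 : F (j s) ≠ 0 := fun h1 => h (hf.self_of_nhds.trans h1)
      filter_upwards [hf, hj.continuousAt.eventually (hF.eventually_ne h0)] with y h1 h2
      simpa [h1] using h2 }

instance {X : Type*} [TopologicalSpace X] [RegularFunctions X] [HasRegularCalculus X]
    (Z : Set X) : HasRegularCalculus Z :=
  HasRegularCalculus.induced Subtype.val continuous_subtype_val

theorem _root_.HasRegularCalculus.coinduced {X Q : Type*} [TopologicalSpace X]
    [RegularFunctions X] [HasRegularCalculus X] [TopologicalSpace Q] (q : X → Q)
    (hq : Topology.IsQuotientMap q) :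
    @HasRegularCalculus Q _ (RegularFunctions.coinduced q hq.continuous) :=
  letI := RegularFunctions.coinduced q hq.continuous
  have key : ∀ {f : Q → ℂ} {m : Q}, RegularAt f m → f m ≠ 0 → ∀ᶠ m' in 𝓝 m, f m' ≠ 0 := by
    intro f m hf h
    obtain ⟨U, hU, hUo, hmU⟩ := eventually_nhds_iff.mp hf
    have ho : IsOpen (U ∩ {m' | f m' ≠ 0}) := by
      rw [← hq.isOpen_preimage, isOpen_iff_mem_nhds]
      rintro x ⟨hx1, hx2⟩
      have h1 := (hU (q x) hx1 x rfl).eventually_ne hx2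
      filter_upwards [h1, (hUo.preimage hq.continuous).mem_nhds hx1] with y hy1 hy2
      exact ⟨hy2, hy1⟩
    filter_upwards [ho.mem_nhds ⟨hmU, h⟩] with y hy
    exact hy.2
  { const := fun a m => Filter.Eventually.of_forall fun _ x _ => RegularAt.const a x
    add := by
      intro f g m hf hg
      filter_upwards [hf, hg] with m' h1 h2 x hx
      exact (h1 x hx).add (h2 x hx)
    mul := by
      intro f g m hf hg
      filter_upwards [hf, hg] with m' h1 h2 x hx
      exact (h1 x hx).mul (h2 x hx)
    inv := by
      intro f m hf h
      filter_upwards [hf, key hf h] with m' h1 h2 x hx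
      exact (h1 x hx).inv (by simpa [hx] using h2)
    eventually_ne := key }

end RegularFunctions

/-! ### Criteria for morphisms -/

section Morphisms

variable {X Y V : Type*} [TopologicalSpace X] [RegularFunctions X] [TopologicalSpace Y]
  [RegularFunctions Y] [TopologicalSpace V] [RegularFunctions V]

theorem IsMorphism.comp {ψ : Y → V} {φ : X → Y} (hψ : IsMorphism ψ) (hφ : IsMorphism φ) :
    IsMorphism (ψ ∘ φ) :=
  ⟨hψ.1.comp hφ.1, fun x g hg => hφ.2 x (g ∘ ψ) (hψ.2 (φ x) g hg)⟩

theorem IsMorphism.subtype_mk {Z : Set Y} {φ : X → Y} (hφ : IsMorphism φ) (h : ∀ x, φ x ∈ Z) :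
    IsMorphism (fun x => (⟨φ x, h x⟩ : Z)) := by
  refine ⟨hφ.1.subtype_mk h, ?_⟩
  rintro x g ⟨F, hF, hg⟩
  refine RegularFunctions.congr ?_ (hφ.2 x F hF)
  exact ((hφ.1.subtype_mk h).continuousAt.eventually hg).mono fun y hy => hy.symm

theorem isMorphism_subtype_val (Z : Set X) : IsMorphism (Subtype.val : Z → X) :=
  ⟨continuous_subtype_val, fun _ g hg => ⟨g, hg, Filter.EventuallyEq.rfl⟩⟩

/-- A map to affine space is a morphism as soon as its coordinates are regular functions. -/
theorem isMorphism_of_coord [HasRegularCalculus X] {ι : Type} {φ : X → ComplexAffineSpace ι}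
    (h : ∀ i x, RegularAt (fun y => (φ y).coord i) x) : IsMorphism φ := by
  have hc : Continuous φ := by
    refine continuous_generateFrom_iff.mpr ?_
    rintro _ ⟨p, rfl⟩
    have := RegularFunctions.isClosed_setOf_eq_zero
      (f := fun y => MvPolynomial.eval (φ y).coord p)
      fun x => RegularFunctions.RegularAt.mvPolynomial (fun i => h i x) p
    exact this.isOpen_compl
  refine ⟨hc, ?_⟩
  rintro x g ⟨p, q, hq, hg⟩
  have hp := RegularFunctions.RegularAt.mvPolynomial (fun i => h i x) p
  have hq' := RegularFunctions.RegularAt.mvPolynomial (fun i => h i x) q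
  refine RegularFunctions.congr ?_ (hp.div hq' hq)
  filter_upwards [hc.continuousAt.eventually hg] with y hy
  exact hy.symm

theorem ComplexAffineSpace.regularAt_coord {ι : Type} (i : ι) (x : ComplexAffineSpace ι) :
    RegularAt (fun y : ComplexAffineSpace ι => y.coord i) x :=
  ⟨MvPolynomial.X i, 1, by simp, by simp⟩

end Morphisms

/-! ### Stratifications from chains of closed sets -/

/-- `ClosedFiltration P F` says that `F` is the last term of a finite increasing chain of closed
sets, starting from `∅`, whose successive differences all have the property `P`. -/
inductive ClosedFiltration {X : Type*} [TopologicalSpace X] (P : Set X → Prop) : Set X → Prop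
  | empty : ClosedFiltration P ∅
  | step {F F' : Set X} : ClosedFiltration P F → F ⊆ F' → IsClosed F' → P (F' \ F) →
      ClosedFiltration P F'

namespace ClosedFiltration

variable {X : Type*} [TopologicalSpace X] {P : Set X → Prop}

theorem isClosed {F : Set X} (h : ClosedFiltration P F) : IsClosed F := by
  cases h with
  | empty => exact isClosed_empty
  | step _ _ h _ => exact h

theorem exists_strata {F : Set X} (h : ClosedFiltration P F) :
    ∃ (N : ℕ) (Z : Fin N → Set X), (∀ j, P (Z j)) ∧ (∀ j, IsLocallyClosed (Z j)) ∧
      Pairwise (fun i j => Disjoint (Z i) (Z j)) ∧ (⋃ j, Z j) = F ∧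
      ∀ a, IsClosed (⋃ j ≤ a, Z j) := by
  induction h with
  | empty => exact ⟨0, fun j => j.elim0, fun j => j.elim0, fun j => j.elim0,
      fun j => j.elim0, by simp, fun j => j.elim0⟩
  | @step F F' hF hsub hF' hP ih =>
    obtain ⟨N, Z, h1, h2, h3, h4, h5⟩ := ih
    have hZF : ∀ j, Z j ⊆ F := fun j => h4 ▸ Set.subset_iUnion Z j
    refine ⟨N + 1, Fin.snoc Z (F' \ F), ?_, ?_, ?_, ?_, ?_⟩
    · intro j
      refine Fin.lastCases ?_ (fun j => ?_) j
      · simpa using hP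
      · simpa using h1 j
    · intro j
      refine Fin.lastCases ?_ (fun j => ?_) j
      · rw [Fin.snoc_last, Set.sdiff_eq]
        exact hF'.isLocallyClosed.inter hF.isClosed.isOpen_compl.isLocallyClosed
      · simpa using h2 j
    · intro i j
      refine Fin.lastCases ?_ (fun i => ?_) i <;> refine Fin.lastCases ?_ (fun j => ?_) j
      · intro h
        exact absurd rfl h
      · intro _
        simpa using Set.disjoint_sdiff_left.mono_right (hZF j)
      · intro _
        simpa using (Set.disjoint_sdiff_left.mono_right (hZF i)).symm
      · intro h
        simpa using h3 (fun e => h (by rw [e]))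
    · ext x
      simp only [Set.mem_iUnion]
      constructor
      · rintro ⟨j, hj⟩
        revert hj
        refine Fin.lastCases ?_ (fun j => ?_) j
        · intro hj
          simp only [Fin.snoc_last] at hj
          exact hj.1
        · intro hj
          simp only [Fin.snoc_castSucc] at hj
          exact hsub (hZF j hj)
      · intro hx
        by_cases hxF : x ∈ F
        · rw [← h4] at hxF
          obtain ⟨j, hj⟩ := Set.mem_iUnion.mp hxF
          exact ⟨j.castSucc, by simpa using hj⟩
        · exact ⟨Fin.last N, by simpa using ⟨hx, hxF⟩⟩
    · intro a
      refine Fin.lastCases ?_ (fun a => ?_) a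
      · convert hF' using 1
        ext x
        simp only [Set.mem_iUnion]
        constructor
        · rintro ⟨j, -, hj⟩
          revert hj
          refine Fin.lastCases ?_ (fun j => ?_) j
          · intro hj
            simp only [Fin.snoc_last] at hj
            exact hj.1
          · intro hj
            simp only [Fin.snoc_castSucc] at hj
            exact hsub (hZF j hj)
        · intro hx
          by_cases hxF : x ∈ F
          · rw [← h4] at hxF
            obtain ⟨j, hj⟩ := Set.mem_iUnion.mp hxF
            exact ⟨j.castSucc, Fin.le_last _, by simpa using hj⟩
          · exact ⟨Fin.last N, le_rfl, by simpa using ⟨hx, hxF⟩⟩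
      · convert h5 a using 1
        ext x
        simp only [Set.mem_iUnion]
        constructor
        · rintro ⟨j, hja, hj⟩
          revert hja hj
          refine Fin.lastCases ?_ (fun j => ?_) j
          · intro hja
            exact absurd hja (by simp)
          · intro hja hj
            exact ⟨j, by simpa using hja, by simpa using hj⟩
        · rintro ⟨j, hja, hj⟩
          exact ⟨j.castSucc, by simpa using hja, by simpa using hj⟩

/-- A filtration of the complement of `U` gives an ordered stratification with open stratum
`U`. -/
theorem exists_isOrderedStratification {U : Set X} (h : ClosedFiltration P Uᶜ) :
    ∃ (N : ℕ) (Z : Fin N → Set X), IsOrderedStratification U Z ∧ ∀ j, P (Z j) := by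
  obtain ⟨N, Z, h1, h2, h3, h4, h5⟩ := h.exists_strata
  refine ⟨N, Z, ⟨by simpa using h.isClosed.isOpen_compl, h2, fun j => ?_, h3, ?_, h5⟩, h1⟩
  · exact Set.disjoint_compl_right_iff_subset.mpr le_rfl |>.mono_right
      (h4 ▸ Set.subset_iUnion Z j)
  · rw [h4, Set.union_compl_self]

theorem union {F D : Set X} (hF : ClosedFiltration P F) (hD : IsClosed D) (h : P (D \ F)) :
    ClosedFiltration P (F ∪ D) :=
  hF.step Set.subset_union_left (hF.isClosed.union hD) (by rwa [Set.union_sdiff_left])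

/-- To enlarge a filtration of `F` by a closed set `D`, it is enough to be able to add
successively the smaller sets `D ∩ C₀ ∩ ⋯ ∩ C_{m-1}`, provided that the smallest one is already
contained in `F`. -/
theorem union_of_chain {F D : Set X} (hF : ClosedFiltration P F) (C : ℕ → Set X) (r : ℕ)
    (hr : D ∩ {x | ∀ l < r, x ∈ C l} ⊆ F)
    (h : ∀ m < r, ClosedFiltration P (F ∪ (D ∩ {x | ∀ l < m + 1, x ∈ C l})) →
      ClosedFiltration P (F ∪ (D ∩ {x | ∀ l < m + 1, x ∈ C l}) ∪ (D ∩ {x | ∀ l < m, x ∈ C l}))) :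
    ClosedFiltration P (F ∪ D) := by
  have key : ∀ s ≤ r, ClosedFiltration P (F ∪ (D ∩ {x | ∀ l < r - s, x ∈ C l})) := by
    intro s
    induction s with
    | zero =>
      intro _
      rw [Nat.sub_zero, Set.union_eq_left.mpr hr]
      exact hF
    | succ s ih =>
      intro hs
      have h1 := h (r - (s + 1)) (by omega)
      rw [show r - (s + 1) + 1 = r - s by omega] at h1
      have h2 := h1 (ih (by omega))
      have hsub : D ∩ {x | ∀ l < r - s, x ∈ C l} ⊆ D ∩ {x | ∀ l < r - (s + 1), x ∈ C l} :=
        fun x hx => ⟨hx.1, fun l hl => hx.2 l (by omega)⟩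
      rwa [Set.union_assoc, Set.union_eq_self_of_subset_left hsub] at h2
  have h0 := key r le_rfl
  rwa [Nat.sub_self, Set.inter_eq_left.mpr (fun x _ l hl => absurd hl (by omega))] at h0

end ClosedFiltration

/-! ### Products of lists of group elements -/

theorem prod_take_ofFn_succ {G : Type*} [Monoid G] {N : ℕ} (M : Fin N → G) (j : Fin N) :
    ((List.ofFn M).take (j + 1)).prod = ((List.ofFn M).take j).prod * M j := by
  rw [List.prod_take_succ _ _ (by simp)]
  simp

theorem prod_take_ofFn_conj {G : Type*} [Group G] {N : ℕ} {M M' : Fin N → G} (g : G) {a b : ℕ}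
    (hab : a ≤ b) (hb : b ≤ N)
    (h : ((List.ofFn M').take a).prod = g * ((List.ofFn M).take a).prod * g⁻¹)
    (hM : ∀ l : Fin N, a ≤ l → l < b → M' l = g * M l * g⁻¹) :
    ((List.ofFn M').take b).prod = g * ((List.ofFn M).take b).prod * g⁻¹ := by
  induction b, hab using Nat.le_induction with
  | base => exact h
  | succ j hj ih =>
    have hjN : j < N := by omega
    have h1 := ih (by omega) fun l h1 h2 => hM l h1 (by omega)
    have h2 := hM ⟨j, hjN⟩ hj (Nat.lt_succ_self j)
    have h3 := prod_take_ofFn_succ M ⟨j, hjN⟩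
    have h4 := prod_take_ofFn_succ M' ⟨j, hjN⟩
    simp only at h3 h4
    rw [h3, h4, h1, h2]
    group

/-! ### Lines in the plane and two by two matrices -/

section Plane

open Matrix

theorem SL2.val_mul_mulVec (A B : SL2) (v : Fin 2 → ℂ) :
    (A * B : SL2).val *ᵥ v = A.val *ᵥ (B.val *ᵥ v) :=
  (Matrix.mulVec_mulVec _ _ _).symm

theorem exists_eq_smul_of_det_eq_zero {v w : Fin 2 → ℂ} (hv : v ≠ 0)
    (hdet : v 0 * w 1 - w 0 * v 1 = 0) : ∃ s : ℂ, w = s • v := by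
  by_cases h0 : v 0 = 0
  · have hv1 : v 1 ≠ 0 := fun h => hv (by ext i; fin_cases i <;> assumption)
    refine ⟨w 1 / v 1, ?_⟩
    have hw : w 0 = 0 := by
      have : v 1 * w 0 = 0 := by linear_combination w 1 * h0 - hdet
      exact (mul_eq_zero.mp this).resolve_left hv1
    ext i
    fin_cases i
    · simp [h0, hw]
    · simp [hv1]
  · refine ⟨w 0 / v 0, ?_⟩
    ext i
    fin_cases i
    · simp [h0]
    · simp only [Fin.mk_one, Pi.smul_apply, smul_eq_mul]
      field_simp
      linear_combination hdet

theorem exists_eq_smul_of_mulVec_eq_zero {M : Matrix (Fin 2) (Fin 2) ℂ} (hM : M ≠ 0)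
    {v w : Fin 2 → ℂ} (hv : v ≠ 0) (h1 : M *ᵥ v = 0) (h2 : M *ᵥ w = 0) : ∃ s : ℂ, w = s • v := by
  refine exists_eq_smul_of_det_eq_zero hv ?_
  by_contra hne
  apply hM
  have e1 := fun i => congrFun h1 i
  have e2 := fun i => congrFun h2 i
  simp only [Matrix.mulVec, dotProduct, Fin.sum_univ_two, Pi.zero_apply] at e1 e2
  have h0 : ∀ i, M i 0 = 0 := fun i => by
    have : M i 0 * (v 0 * w 1 - w 0 * v 1) = 0 := by
      linear_combination w 1 * e1 i - v 1 * e2 i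
    exact (mul_eq_zero.mp this).resolve_right hne
  have h1 : ∀ i, M i 1 = 0 := fun i => by
    have : M i 1 * (v 0 * w 1 - w 0 * v 1) = 0 := by
      linear_combination -w 0 * e1 i + v 0 * e2 i
    exact (mul_eq_zero.mp this).resolve_right hne
  ext i j
  fin_cases j
  · exact h0 i
  · exact h1 i

theorem exists_mulVec_ne_zero {M : Matrix (Fin 2) (Fin 2) ℂ} (hM : M ≠ 0) :
    ∃ w, M *ᵥ w ≠ 0 := by
  by_contra! h
  exact hM (Matrix.ext_of_mulVec_single fun i => by rw [h, Matrix.zero_mulVec])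

/-- The Cayley–Hamilton relation in `SL₂`. -/
theorem sub_smul_mul_sub_smul_eq_zero {T : SL2} {μ : ℂ} (hμ : μ ≠ 0)
    (htr : T.val.trace = μ + μ⁻¹) : (T.val - μ • 1) * (T.val - μ⁻¹ • 1) = 0 := by
  have hdet := T.2
  rw [Matrix.det_fin_two] at hdet
  rw [Matrix.trace_fin_two] at htr
  have h1 : μ * μ⁻¹ = 1 := mul_inv_cancel₀ hμ
  ext i j
  fin_cases i <;> fin_cases j <;>
    simp [Matrix.mul_apply, Fin.sum_univ_two, Matrix.one_apply]
  · linear_combination T.val 0 0 * htr + h1 - hdet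
  · linear_combination T.val 0 1 * htr
  · linear_combination T.val 1 0 * htr
  · linear_combination T.val 1 1 * htr + h1 - hdet

/-- When `T ∈ SL₂` is not scalar and has eigenvalues `μ` and `μ⁻¹`, this matrix vanishes exactly
when `X` preserves the `μ`-eigenline of `T`, since that line is both the kernel of `T - μ` and the
image of `T - μ⁻¹`. -/
noncomputable def lineDefect (T : Matrix (Fin 2) (Fin 2) ℂ) (μ : ℂ) (X : Matrix (Fin 2) (Fin 2) ℂ) :
    Matrix (Fin 2) (Fin 2) ℂ :=
  (T - μ • 1) * X * (T - μ⁻¹ • 1)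

theorem exists_eigenvector {T : SL2} {μ : ℂ} (hμ : μ ≠ 0) (htr : T.val.trace = μ + μ⁻¹)
    (hT : T.val ≠ μ⁻¹ • 1) : ∃ v, v ≠ 0 ∧ T.val *ᵥ v = μ • v ∧ ∃ w, v = (T.val - μ⁻¹ • 1) *ᵥ w := by
  obtain ⟨w, hw⟩ := exists_mulVec_ne_zero (sub_ne_zero.mpr hT)
  refine ⟨_, hw, ?_, w, rfl⟩
  have := congrArg (· *ᵥ w) (sub_smul_mul_sub_smul_eq_zero hμ htr)
  simp only [← Matrix.mulVec_mulVec, Matrix.zero_mulVec] at this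
  rw [Matrix.sub_mulVec, Matrix.smul_mulVec, Matrix.one_mulVec] at this
  exact sub_eq_zero.mp this

theorem eigenvector_unique {T : Matrix (Fin 2) (Fin 2) ℂ} {μ : ℂ} (hT : T ≠ μ • 1)
    {v w : Fin 2 → ℂ} (hv : v ≠ 0) (h1 : T *ᵥ v = μ • v) (h2 : T *ᵥ w = μ • w) :
    ∃ s : ℂ, w = s • v :=
  exists_eq_smul_of_mulVec_eq_zero (sub_ne_zero.mpr hT) hv
    (by rw [Matrix.sub_mulVec, Matrix.smul_mulVec, Matrix.one_mulVec, h1, sub_self])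
    (by rw [Matrix.sub_mulVec, Matrix.smul_mulVec, Matrix.one_mulVec, h2, sub_self])

theorem lineDefect_eq_zero_iff {T : SL2} {μ : ℂ} (hμ : μ ≠ 0) (htr : T.val.trace = μ + μ⁻¹)
    (hT : T.val ≠ μ • 1) (hT' : T.val ≠ μ⁻¹ • 1) {v : Fin 2 → ℂ} (hv : v ≠ 0)
    (hTv : T.val *ᵥ v = μ • v) {X : Matrix (Fin 2) (Fin 2) ℂ} :
    lineDefect T.val μ X = 0 ↔ ∃ b : ℂ, X *ᵥ v = b • v := by
  constructor
  · intro h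
    obtain ⟨v', hv', hTv', w, hw⟩ := exists_eigenvector hμ htr hT'
    have h1 := congrArg (· *ᵥ w) h
    simp only [lineDefect, ← Matrix.mulVec_mulVec, Matrix.zero_mulVec, ← hw] at h1
    rw [Matrix.sub_mulVec, Matrix.smul_mulVec, Matrix.one_mulVec, sub_eq_zero] at h1
    obtain ⟨s, rfl⟩ := eigenvector_unique hT hv' hTv' hTv
    obtain ⟨b, hb⟩ := eigenvector_unique hT hv' hTv' h1
    exact ⟨b, by rw [Matrix.mulVec_smul, hb, smul_comm]⟩
  · rintro ⟨b, hb⟩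
    by_contra h
    obtain ⟨w, hw⟩ := exists_mulVec_ne_zero h
    apply hw
    have h1 := congrArg (· *ᵥ w) (sub_smul_mul_sub_smul_eq_zero hμ htr)
    simp only [← Matrix.mulVec_mulVec, Matrix.zero_mulVec] at h1
    simp only [lineDefect, ← Matrix.mulVec_mulVec]
    generalize (T.val - μ⁻¹ • 1) *ᵥ w = u at h1 ⊢
    rw [Matrix.sub_mulVec, Matrix.smul_mulVec, Matrix.one_mulVec, sub_eq_zero] at h1
    obtain ⟨s, rfl⟩ := eigenvector_unique hT hv hTv h1
    rw [Matrix.mulVec_smul, hb, Matrix.sub_mulVec, Matrix.smul_mulVec, Matrix.one_mulVec]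
    simp only [Matrix.mulVec_smul, hTv]
    rw [sub_eq_zero]
    module

/-- If the `μ`-eigenline of `T` is spanned by the first basis vector, the matrices that preserve
it are the upper triangular ones. -/
theorem lineDefect_eq_zero_iff_of_upper {T : SL2} {μ : ℂ} (hμ : μ ≠ 0)
    (hT : T.val ≠ μ • 1) (hT' : T.val ≠ μ⁻¹ • 1) (h00 : T.val 0 0 = μ) (h10 : T.val 1 0 = 0)
    {X : Matrix (Fin 2) (Fin 2) ℂ} :
    lineDefect T.val μ X = 0 ↔ X 1 0 = 0 := by
  have hdet := T.2
  rw [Matrix.det_fin_two, h00, h10] at hdet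
  have h11 : T.val 1 1 = μ⁻¹ := by
    field_simp
    linear_combination hdet
  have hv : (![1, 0] : Fin 2 → ℂ) ≠ 0 := fun h => one_ne_zero (congrFun h 0)
  rw [lineDefect_eq_zero_iff hμ (by rw [Matrix.trace_fin_two, h00, h11]) hT hT' hv]
  · constructor
    · rintro ⟨b, hb⟩
      simpa [Matrix.mulVec, dotProduct, Fin.sum_univ_two] using congrFun hb 1
    · intro h
      refine ⟨X 0 0, ?_⟩
      ext i
      fin_cases i <;> simp [Matrix.mulVec, dotProduct, Fin.sum_univ_two, h]
  · ext i
    fin_cases i <;> simp [Matrix.mulVec, dotProduct, Fin.sum_univ_two, h00, h10]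

/-- The matrix `1` with an entry `x` added above the diagonal. -/
def upperUnipotent (x : ℂ) : SL2 := ⟨!![1, x; 0, 1], by simp [Matrix.det_fin_two]⟩

theorem upperUnipotent_val (x : ℂ) : (upperUnipotent x).val = !![1, x; 0, 1] := rfl

theorem upperUnipotent_mul (x y : ℂ) :
    upperUnipotent x * upperUnipotent y = upperUnipotent (x + y) := by
  apply Subtype.ext
  rw [Matrix.SpecialLinearGroup.coe_mul]
  simp only [upperUnipotent_val]
  ext i j
  fin_cases i <;> fin_cases j <;> simp [Matrix.mul_apply, Fin.sum_univ_two, add_comm]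

theorem upperUnipotent_zero : upperUnipotent 0 = 1 := by
  ext i j
  fin_cases i <;> fin_cases j <;> simp [upperUnipotent]

theorem upperUnipotent_inv (x : ℂ) : (upperUnipotent x)⁻¹ = upperUnipotent (-x) :=
  inv_eq_of_mul_eq_one_right (by rw [upperUnipotent_mul, add_neg_cancel, upperUnipotent_zero])

theorem upperUnipotent_conj (x : ℂ) (A : SL2) :
    (upperUnipotent x * A * (upperUnipotent x)⁻¹).val =
      !![A.val 0 0 + x * A.val 1 0,
          A.val 0 1 + x * A.val 1 1 - x * (A.val 0 0 + x * A.val 1 0);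
        A.val 1 0, A.val 1 1 - x * A.val 1 0] := by
  rw [upperUnipotent_inv, Matrix.SpecialLinearGroup.coe_mul, Matrix.SpecialLinearGroup.coe_mul]
  simp only [upperUnipotent_val]
  ext i j
  fin_cases i <;> fin_cases j <;>
    simp [Matrix.mul_apply, Matrix.vecMul, dotProduct, Fin.sum_univ_two] <;> ring

theorem upperUnipotent_conj_add (x y : ℂ) (A : SL2) :
    upperUnipotent x * (upperUnipotent y * A * (upperUnipotent y)⁻¹) * (upperUnipotent x)⁻¹ =
      upperUnipotent (x + y) * A * (upperUnipotent (x + y))⁻¹ := by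
  rw [← upperUnipotent_mul]
  group

theorem trace_conj (P : GL (Fin 2) ℂ) (X : Matrix (Fin 2) (Fin 2) ℂ) :
    (P.val * X * P⁻¹.val).trace = X.trace := by
  rw [Matrix.trace_mul_comm, ← mul_assoc, Units.inv_mul, one_mul]

theorem conj_eq_iff (P : GL (Fin 2) ℂ) (X Y : Matrix (Fin 2) (Fin 2) ℂ) :
    Y = P.val * X * P⁻¹.val ↔ X = P⁻¹.val * Y * P.val := by
  constructor
  · rintro rfl
    simp [mul_assoc]
  · rintro rfl
    simp [mul_assoc]

end Plane

section EigenClass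

open Matrix

theorem trace_of_mem_eigenClass {a : ℂ} {A : SL2} (h : A ∈ eigenClass a) :
    A.val.trace = a + a⁻¹ := by
  obtain ⟨P, hP⟩ := h
  rw [hP, trace_conj, Matrix.trace_fin_two]
  simp

theorem inv_ne_self_of_ne {a : ℂ} (h0 : a ≠ 0) (h1 : a ≠ 1) (h2 : a ≠ -1) : a⁻¹ ≠ a := by
  intro h
  have h3 : a * a = 1 := by
    nth_rewrite 1 [← h]
    exact inv_mul_cancel₀ h0
  exact (mul_self_eq_one_iff.mp h3).elim h1 h2

theorem trace_smul_one (a : ℂ) : (a • (1 : Matrix (Fin 2) (Fin 2) ℂ)).trace = 2 * a := by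
  simp [mul_comm]

theorem ne_smul_one_of_trace {a : ℂ} (h : a⁻¹ ≠ a) {A : Matrix (Fin 2) (Fin 2) ℂ}
    (hA : A.trace = a + a⁻¹) : A ≠ a • 1 ∧ A ≠ a⁻¹ • 1 := by
  constructor
  · rintro rfl
    rw [trace_smul_one] at hA
    exact h (by linear_combination -hA)
  · rintro rfl
    rw [trace_smul_one] at hA
    exact h (by linear_combination hA)

theorem mem_eigenClass_iff {a : ℂ} (h0 : a ≠ 0) (h : a⁻¹ ≠ a) {A : SL2} :
    A ∈ eigenClass a ↔ A.val.trace = a + a⁻¹ := by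
  refine ⟨trace_of_mem_eigenClass, fun hA => ?_⟩
  obtain ⟨hne, hne'⟩ := ne_smul_one_of_trace h hA
  obtain ⟨v, hv, hAv, -⟩ := exists_eigenvector h0 hA hne'
  obtain ⟨w, hw, hAw, -⟩ := exists_eigenvector (inv_ne_zero h0)
    (by rw [hA, inv_inv, add_comm]) (by rwa [inv_inv])
  have hdet : (!![v 0, w 0; v 1, w 1]).det ≠ 0 := by
    intro hdet
    rw [Matrix.det_fin_two_of] at hdet
    -- a vanishing determinant makes `w` a multiple of `v`, so both eigenvalues agree
    obtain ⟨s, rfl⟩ := exists_eq_smul_of_det_eq_zero hv hdet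
    rw [Matrix.mulVec_smul, hAv] at hAw
    have hz : (a⁻¹ - a) • (s • v) = 0 := by
      rw [sub_smul, ← hAw, smul_comm, sub_self]
    exact (smul_eq_zero.mp hz).elim (fun h' => h (sub_eq_zero.mp h')) hw
  obtain ⟨P, hP⟩ : ∃ P : GL (Fin 2) ℂ, P.val = !![v 0, w 0; v 1, w 1] :=
    ⟨Matrix.GeneralLinearGroup.mkOfDetNeZero _ hdet, rfl⟩
  have key : A.val * P.val = P.val * Matrix.diagonal ![a, a⁻¹] := by
    have e1 := fun i => congrFun hAv i
    have e2 := fun i => congrFun hAw i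
    simp only [Matrix.mulVec, dotProduct, Fin.sum_univ_two, Pi.smul_apply, smul_eq_mul] at e1 e2
    rw [hP]
    ext i j
    fin_cases i <;> fin_cases j <;>
      simp [Matrix.mul_apply, Fin.sum_univ_two, e1, e2, mul_comm _ a, mul_comm _ a⁻¹]
  exact ⟨P, by rw [← key, mul_assoc, Units.mul_inv, mul_one]⟩

end EigenClass

/-! ### Framed local systems and their moduli space as spaces with functions -/

section Framed

variable {n : ℕ} {c : Fin (n + 3) → ℂ}

namespace FramedLocalSystem

theorem ext_mat {A B : FramedLocalSystem c} (h : ∀ i, A.mat i = B.mat i) : A = B := by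
  cases A
  cases B
  congr
  exact funext h

instance : HasRegularCalculus (FramedLocalSystem c) :=
  HasRegularCalculus.induced entries continuous_induced_dom

theorem isInducing_entries : Topology.IsInducing (entries (c := c)) := ⟨rfl⟩

theorem regularAt_mat (l : Fin (n + 3)) (i j : Fin 2) (A : FramedLocalSystem c) :
    RegularAt (fun A : FramedLocalSystem c => (A.mat l).val i j) A :=
  ⟨fun x => x.coord (l, i, j), ComplexAffineSpace.regularAt_coord _ _, Filter.EventuallyEq.rfl⟩

theorem isMorphism_of_mat {X : Type*} [TopologicalSpace X] [RegularFunctions X]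
    [HasRegularCalculus X] {φ : X → FramedLocalSystem c}
    (h : ∀ l i j x, RegularAt (fun y => ((φ y).mat l).val i j) x) : IsMorphism φ := by
  have he : IsMorphism (entries ∘ φ) := isMorphism_of_coord fun i x => h i.1 i.2.1 i.2.2 x
  refine ⟨isInducing_entries.continuous_iff.mpr he.1, ?_⟩
  rintro x g ⟨F, hF, hg⟩
  refine RegularFunctions.congr ?_ (he.2 x F hF)
  exact ((isInducing_entries.continuous_iff.mpr he.1).continuousAt.eventually hg).mono
    fun _ hy => hy.symm

theorem partialProd_zero (A : FramedLocalSystem c) : A.partialProd 0 = 1 := by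
  simp [partialProd]

theorem partialProd_succ (A : FramedLocalSystem c) (j : Fin (n + 3)) :
    A.partialProd (j + 1) = A.partialProd j * A.mat j :=
  prod_take_ofFn_succ _ _

theorem partialProd_all (A : FramedLocalSystem c) : A.partialProd (n + 3) = 1 := by
  rw [partialProd, List.take_of_length_le (by simp), A.prod_eq_one]

theorem partialProd_congr {A B : FramedLocalSystem c} {j : ℕ} (hj : j ≤ n + 3)
    (h : ∀ l : Fin (n + 3), l < j → B.mat l = A.mat l) : B.partialProd j = A.partialProd j := by
  have key := prod_take_ofFn_conj (M := A.mat) (M' := B.mat) 1 (Nat.zero_le j) hj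
    (by rw [List.take_zero, List.take_zero, List.prod_nil, mul_one, inv_one, mul_one])
    fun l _ hl => by rw [h l hl, one_mul, inv_one, mul_one]
  rwa [one_mul, inv_one, mul_one] at key

/-- The framed local system with prescribed matrices, obtained from `A` by conjugating each matrix
by an element of `SL₂` in such a way that the product remains `1`. -/
def twist (A : FramedLocalSystem c) (g : Fin (n + 3) → SL2)
    (h : (List.ofFn fun l => g l * A.mat l * (g l)⁻¹).prod = 1) : FramedLocalSystem c where
  mat l := g l * A.mat l * (g l)⁻¹
  mem_class l := by
    obtain ⟨P, hP⟩ := A.mem_class l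
    refine ⟨Matrix.SpecialLinearGroup.toGL (g l) * P, ?_⟩
    have h1 : (Matrix.SpecialLinearGroup.toGL (g l))⁻¹.val = ((g l)⁻¹ : SL2).val := by
      rw [← map_inv]
      rfl
    rw [Matrix.SpecialLinearGroup.coe_mul, Matrix.SpecialLinearGroup.coe_mul, hP, mul_inv_rev,
      Units.val_mul, Units.val_mul, h1]
    simp only [mul_assoc]
    rfl
  prod_eq_one := h

end FramedLocalSystem

open FramedLocalSystem

namespace ModuliSpace

theorem isQuotientMap_mk : Topology.IsQuotientMap (mk : FramedLocalSystem c → ModuliSpace c) :=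
  ⟨⟨rfl⟩, Quotient.mk_surjective⟩

instance : HasRegularCalculus (ModuliSpace c) :=
  HasRegularCalculus.coinduced mk isQuotientMap_mk

theorem isMorphism_mk : IsMorphism (mk : FramedLocalSystem c → ModuliSpace c) :=
  ⟨isQuotientMap_mk.continuous, fun x _ hg => hg.self_of_nhds x rfl⟩

theorem mk_eq_mk_iff {A B : FramedLocalSystem c} : mk A = mk B ↔ ∃ P : GL (Fin 2) ℂ, ∀ i,
    (B.mat i : Matrix (Fin 2) (Fin 2) ℂ) = P.val * (A.mat i).val * P⁻¹.val :=
  Quotient.eq (r := FramedLocalSystem.conjSetoid c)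

theorem exists_mk (z : ModuliSpace c) : ∃ A, mk A = z := Quotient.mk_surjective z

/-- The set of isomorphism classes of framed local systems with a property. -/
def locus (Q : FramedLocalSystem c → Prop) : Set (ModuliSpace c) := mk '' {A | Q A}

/-- A property of framed local systems that depends only on the isomorphism class. -/
def IsInvariant (Q : FramedLocalSystem c → Prop) : Prop := ∀ A B, mk A = mk B → Q A → Q B

theorem mk_mem_locus {Q : FramedLocalSystem c → Prop} (hQ : IsInvariant Q)
    {A : FramedLocalSystem c} : mk A ∈ locus Q ↔ Q A :=
  ⟨fun ⟨B, hB, h⟩ => hQ B A h hB, fun h => ⟨A, h, rfl⟩⟩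

theorem isClosed_locus {Q : FramedLocalSystem c → Prop} (hQ : IsInvariant Q)
    (h : IsClosed {A | Q A}) : IsClosed (locus Q) := by
  rw [← isQuotientMap_mk.isClosed_preimage]
  convert h using 1
  ext A
  exact mk_mem_locus hQ

end ModuliSpace

open ModuliSpace

/-- A matrix-valued function of framed local systems that has regular entries and is compatible
with simultaneous conjugation. -/
structure IsEquivariantRegular (G : FramedLocalSystem c → Matrix (Fin 2) (Fin 2) ℂ) : Prop where
  regular : ∀ i j A, RegularAt (fun A => G A i j) A
  conj : ∀ A B (P : GL (Fin 2) ℂ), (∀ i, (B.mat i).val = P.val * (A.mat i).val * P⁻¹.val) →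
    G B = P.val * G A * P⁻¹.val

namespace IsEquivariantRegular

variable {G H : FramedLocalSystem c → Matrix (Fin 2) (Fin 2) ℂ}

theorem mat (l : Fin (n + 3)) :
    IsEquivariantRegular (fun A : FramedLocalSystem c => (A.mat l).val) :=
  ⟨fun i j A => regularAt_mat l i j A, fun _ _ _ h => h l⟩

theorem smul_one (a : ℂ) :
    IsEquivariantRegular (fun _ : FramedLocalSystem c => a • (1 : Matrix (Fin 2) (Fin 2) ℂ)) :=
  ⟨fun _ _ A => RegularFunctions.RegularAt.const _ A, fun _ _ P _ => by simp⟩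

theorem mul (hG : IsEquivariantRegular G) (hH : IsEquivariantRegular H) :
    IsEquivariantRegular (fun A => G A * H A) := by
  refine ⟨fun i j A => ?_, fun A B P h => ?_⟩
  · simp only [Matrix.mul_apply, Fin.sum_univ_two]
    exact ((hG.regular _ _ A).mul (hH.regular _ _ A)).add
      ((hG.regular _ _ A).mul (hH.regular _ _ A))
  · simp [hG.conj A B P h, hH.conj A B P h, mul_assoc]

theorem sub (hG : IsEquivariantRegular G) (hH : IsEquivariantRegular H) :
    IsEquivariantRegular (fun A => G A - H A) := by
  refine ⟨fun i j A => ?_, fun A B P h => ?_⟩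
  · simp only [Matrix.sub_apply]
    exact (hG.regular _ _ A).sub (hH.regular _ _ A)
  · simp [hG.conj A B P h, hH.conj A B P h, mul_sub, sub_mul]

theorem partialProd {j : ℕ} (hj : j ≤ n + 3) :
    IsEquivariantRegular (fun A : FramedLocalSystem c => (A.partialProd j).val) := by
  induction j with
  | zero => simpa [partialProd_zero] using smul_one (c := c) 1
  | succ j ih =>
    have h := (ih (by omega)).mul (mat ⟨j, by omega⟩)
    have e : ∀ A : FramedLocalSystem c, (A.partialProd (j + 1)).val =
        (A.partialProd j).val * (A.mat ⟨j, by omega⟩).val := fun A => by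
      rw [← Matrix.SpecialLinearGroup.coe_mul, ← A.partialProd_succ ⟨j, by omega⟩]
    simpa only [e] using h

theorem lineDefect (hG : IsEquivariantRegular G) (hH : IsEquivariantRegular H) (μ : ℂ) :
    IsEquivariantRegular (fun A => lineDefect (G A) μ (H A)) :=
  ((hG.sub (smul_one μ)).mul hH).mul (hG.sub (smul_one μ⁻¹))

theorem trace_eq (hG : IsEquivariantRegular G) {A B : FramedLocalSystem c} (h : ModuliSpace.mk A = ModuliSpace.mk B) :
    (G A).trace = (G B).trace := by
  obtain ⟨P, hP⟩ := mk_eq_mk_iff.mp h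
  rw [hG.conj A B P hP, trace_conj]

theorem eq_smul_one_iff (hG : IsEquivariantRegular G) {A B : FramedLocalSystem c}
    (h : ModuliSpace.mk A = ModuliSpace.mk B) (a : ℂ) : G A = a • 1 ↔ G B = a • 1 := by
  obtain ⟨P, hP⟩ := mk_eq_mk_iff.mp h
  constructor
  · intro h0
    rw [hG.conj A B P hP, h0]
    simp
  · intro h0
    rw [(conj_eq_iff P _ _).mp (hG.conj A B P hP), h0]
    simp

theorem eq_zero_iff (hG : IsEquivariantRegular G) {A B : FramedLocalSystem c}
    (h : ModuliSpace.mk A = ModuliSpace.mk B) : G A = 0 ↔ G B = 0 := by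
  simpa using hG.eq_smul_one_iff h 0

theorem isClosed_setOf_eq_smul_one (hG : IsEquivariantRegular G) (a : ℂ) :
    IsClosed {A | G A = a • 1} := by
  have h : {A | G A = a • 1} = ⋂ i, ⋂ j, {A | G A i j = (a • 1 : Matrix _ _ ℂ) i j} := by
    ext A
    simp only [Set.mem_iInter]
    exact Matrix.ext_iff.symm
  rw [h]
  exact isClosed_iInter fun i => isClosed_iInter fun j =>
    RegularFunctions.isClosed_setOf_eq (fun A => hG.regular i j A) _

theorem isClosed_setOf_eq_zero (hG : IsEquivariantRegular G) : IsClosed {A | G A = 0} := by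
  simpa using hG.isClosed_setOf_eq_smul_one 0

theorem regularAt_trace (hG : IsEquivariantRegular G) (A : FramedLocalSystem c) :
    RegularAt (fun A => (G A).trace) A := by
  simp only [Matrix.trace_fin_two]
  exact (hG.regular 0 0 A).add (hG.regular 1 1 A)

theorem isClosed_setOf_trace_eq (hG : IsEquivariantRegular G) (a : ℂ) :
    IsClosed {A | (G A).trace = a} :=
  RegularFunctions.isClosed_setOf_eq (fun A => hG.regularAt_trace A) a

/-- Traces of equivariant regular matrices are regular functions on the moduli space. -/
theorem exists_trace (hG : IsEquivariantRegular G) : ∃ F : ModuliSpace c → ℂ,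
    (∀ z, RegularAt F z) ∧ ∀ A, F (ModuliSpace.mk A) = (G A).trace := by
  refine ⟨Quotient.lift (fun A => (G A).trace) fun A B h => hG.trace_eq (Quotient.sound h),
    fun z => ?_, fun A => rfl⟩
  exact Filter.Eventually.of_forall fun _ A _ => hG.regularAt_trace A

end IsEquivariantRegular

/-- The framed local systems form a closed subset of the
affine space of matrix entries: for eigenvalues other than `±1`, a matrix of determinant `1` lies
in the conjugacy class as soon as its trace is right. -/
theorem FramedLocalSystem.isClosed_range_entries
    (hc : ∀ i, c i ≠ 0 ∧ c i ≠ 1 ∧ c i ≠ -1) : IsClosed (Set.range (entries (c := c))) := by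
  let M : ComplexAffineSpace (Fin (n + 3) × Fin 2 × Fin 2) → Fin (n + 3) →
    Matrix (Fin 2) (Fin 2) ℂ := fun x l => Matrix.of fun i j => x.coord (l, i, j)
  have hM : ∀ l i j x, RegularAt (fun y => M y l i j) x :=
    fun l i j x => ComplexAffineSpace.regularAt_coord _ _
  have hprod : ∀ (s : List (Fin (n + 3))) i j x,
      RegularAt (fun y => (s.map (M y)).prod i j) x := by
    intro s
    induction s with
    | nil => exact fun i j x => RegularFunctions.RegularAt.const _ x
    | cons l s ih =>
      intro i j x
      simp only [List.map_cons, List.prod_cons, Matrix.mul_apply, Fin.sum_univ_two]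
      exact ((hM _ _ _ _).mul (ih _ _ _)).add ((hM _ _ _ _).mul (ih _ _ _))
  have heq : Set.range (entries (c := c)) =
      (⋂ l, {x | (M x l).det = 1}) ∩ (⋂ l, {x | (M x l).trace = c l + (c l)⁻¹}) ∩
      ⋂ i, ⋂ j, {x | ((List.finRange (n + 3)).map (M x)).prod i j
        = (1 : Matrix (Fin 2) (Fin 2) ℂ) i j} := by
    ext x
    simp only [Set.mem_inter_iff, Set.mem_iInter]
    constructor
    · rintro ⟨A, rfl⟩
      have hMA : ∀ l, M A.entries l = (A.mat l).val := fun l => rfl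
      refine ⟨⟨fun l => (A.mat l).2, fun l => trace_of_mem_eigenClass (A.mem_class l)⟩,
        fun i j => ?_⟩
      have h2 : ∀ s : List (Fin (n + 3)),
          (s.map (M A.entries)).prod = ((s.map A.mat).prod).val := by
        intro s
        induction s with
        | nil => simp
        | cons l s ih => simp [ih, hMA]
      show (List.map (M A.entries) _).prod i j = _
      rw [h2, ← List.ofFn_eq_map, A.prod_eq_one]
      simp
    · rintro ⟨⟨h1, h2⟩, h3⟩
      let B : Fin (n + 3) → SL2 := fun l => ⟨M x l, h1 l⟩
      have h4 : ∀ s : List (Fin (n + 3)), (s.map (M x)).prod = ((s.map B).prod).val := by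
        intro s
        induction s with
        | nil => simp
        | cons l s ih =>
          rw [List.map_cons, List.prod_cons, List.map_cons, List.prod_cons,
            Matrix.SpecialLinearGroup.coe_mul, ih]
      refine ⟨⟨B, fun l => ?_, ?_⟩, rfl⟩
      · obtain ⟨e0, e1, e2⟩ := hc l
        exact (mem_eigenClass_iff e0 (inv_ne_self_of_ne e0 e1 e2)).mpr (h2 l)
      · apply Subtype.ext
        rw [List.ofFn_eq_map, ← h4]
        ext i j
        simpa using h3 i j
  rw [heq]
  refine ((isClosed_iInter fun l => ?_).inter (isClosed_iInter fun l => ?_)).inter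
    (isClosed_iInter fun i => isClosed_iInter fun j =>
      RegularFunctions.isClosed_setOf_eq (hprod _ _ _) _)
  · simp only [Matrix.det_fin_two]
    exact RegularFunctions.isClosed_setOf_eq
      (fun x => ((hM _ _ _ x).mul (hM _ _ _ x)).sub ((hM _ _ _ x).mul (hM _ _ _ x))) _
  · simp only [Matrix.trace_fin_two]
    exact RegularFunctions.isClosed_setOf_eq (fun x => (hM _ _ _ x).add (hM _ _ _ x)) _

end Framed

/-! ### Irreducibility of very generic local systems -/

section Irreducibility

open Matrix

variable {n : ℕ} {c : Fin (n + 3) → ℂ}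

open FramedLocalSystem hiding mk
open ModuliSpace

theorem FramedLocalSystem.trace_mat (A : FramedLocalSystem c) (l : Fin (n + 3)) :
    (A.mat l).val.trace = c l + (c l)⁻¹ :=
  trace_of_mem_eigenClass (A.mem_class l)

theorem FramedLocalSystem.eigenvalue_mat (hc : ∀ i, c i ≠ 0) (A : FramedLocalSystem c)
    {l : Fin (n + 3)} {v : Fin 2 → ℂ} (hv : v ≠ 0) {b : ℂ} (h : (A.mat l).val *ᵥ v = b • v) :
    ∃ e : ℤˣ, b = c l ^ (e : ℤ) := by
  have h1 := congrArg (· *ᵥ v) (sub_smul_mul_sub_smul_eq_zero (hc l) (A.trace_mat l))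
  simp only [← Matrix.mulVec_mulVec, Matrix.zero_mulVec, Matrix.sub_mulVec, Matrix.smul_mulVec,
    Matrix.one_mulVec, h, Matrix.mulVec_sub, Matrix.mulVec_smul] at h1
  have h2 : ((b - c l) * (b - (c l)⁻¹)) • v = 0 := by
    rw [← h1]
    module
  rcases mul_eq_zero.mp ((smul_eq_zero.mp h2).resolve_right hv) with h3 | h3
  · exact ⟨1, by simpa using sub_eq_zero.mp h3⟩
  · exact ⟨-1, by simpa using sub_eq_zero.mp h3⟩

theorem FramedLocalSystem.partialProd_mulVec (A : FramedLocalSystem c) {v : Fin 2 → ℂ} {i j : ℕ}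
    (hij : i ≤ j) (hj : j ≤ n + 3) {e : ℂ} (he : (A.partialProd i).val *ᵥ v = e • v)
    {b : Fin (n + 3) → ℂ} (hb : ∀ l : Fin (n + 3), i ≤ l → l < j → (A.mat l).val *ᵥ v = b l • v) :
    (A.partialProd j).val *ᵥ v =
      (e * ∏ l ∈ Finset.univ.filter (fun l : Fin (n + 3) => i ≤ l ∧ l < j), b l) • v := by
  induction j, hij using Nat.le_induction with
  | base =>
    rw [Finset.filter_false_of_mem (fun l _ h => by omega), Finset.prod_empty, mul_one, he]
  | succ j hij ih =>
    have hjn : j < n + 3 := by omega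
    have h1 := ih (by omega) fun l h1 h2 => hb l h1 (by omega)
    have hset : Finset.univ.filter (fun l : Fin (n + 3) => i ≤ l ∧ l < j + 1) =
        insert ⟨j, hjn⟩ (Finset.univ.filter (fun l : Fin (n + 3) => i ≤ l ∧ l < j)) := by
      ext l
      simp only [Finset.mem_filter, Finset.mem_univ, true_and, Finset.mem_insert, Fin.ext_iff]
      omega
    have h2 : A.partialProd (j + 1) = A.partialProd j * A.mat ⟨j, hjn⟩ :=
      A.partialProd_succ ⟨j, hjn⟩
    rw [hset, Finset.prod_insert (by simp), h2, Matrix.SpecialLinearGroup.coe_mul,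
      ← Matrix.mulVec_mulVec, hb ⟨j, hjn⟩ hij (Nat.lt_succ_self j), Matrix.mulVec_smul, h1,
      smul_smul]
    congr 1
    ring

theorem FramedLocalSystem.exists_signs (hc : ∀ i, c i ≠ 0) (A : FramedLocalSystem c)
    {v : Fin 2 → ℂ} (hv : v ≠ 0) (p : Fin (n + 3) → Prop)
    (h : ∀ l, p l → ∃ b : ℂ, (A.mat l).val *ᵥ v = b • v) :
    ∃ e : Fin (n + 3) → ℤˣ, ∀ l, p l → (A.mat l).val *ᵥ v = (c l ^ (e l : ℤ)) • v := by
  have h1 : ∀ l, ∃ e : ℤˣ, p l → (A.mat l).val *ᵥ v = (c l ^ (e : ℤ)) • v := by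
    intro l
    by_cases hl : p l
    · obtain ⟨b, hb⟩ := h l hl
      obtain ⟨e, rfl⟩ := A.eigenvalue_mat hc hv hb
      exact ⟨e, fun _ => hb⟩
    · exact ⟨1, fun h => absurd h hl⟩
  choose e he using h1
  exact ⟨e, he⟩

/-- If the monodromy around `ρ_i` has an eigenvector with eigenvalue `±1`, then this eigenvector
is not a common eigenvector of `A₁, …, A_i`. -/
theorem VeryGeneric.exists_not_eigenvector_left (hgen : VeryGeneric c) (hc : ∀ i, c i ≠ 0)
    (A : FramedLocalSystem c) {i : ℕ} (hi : 1 ≤ i) (hi' : i ≤ n + 3) {v : Fin 2 → ℂ} (hv : v ≠ 0)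
    {e : ℂ} (he : e = 1 ∨ e = -1) (h : (A.partialProd i).val *ᵥ v = e • v) :
    ∃ l : Fin (n + 3), l < i ∧ ¬∃ b : ℂ, (A.mat l).val *ᵥ v = b • v := by
  by_contra! hcon
  obtain ⟨ε, hε⟩ := A.exists_signs hc hv (fun l => l < i) hcon
  have h1 := A.partialProd_mulVec (v := v) (e := 1) (Nat.zero_le i) hi'
    (by simp [partialProd_zero]) fun l _ hl => hε l hl
  rw [h, one_mul] at h1
  have hset : Finset.univ.filter (fun l : Fin (n + 3) => 0 ≤ (l : ℕ) ∧ l < i) =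
      Finset.Iic ⟨i - 1, by omega⟩ := by
    ext l
    simp only [Finset.mem_filter, Finset.mem_univ, true_and, Finset.mem_Iic, Fin.le_def]
    omega
  rw [hset] at h1
  have h2 := smul_left_injective ℂ hv h1
  have h3 := (hgen ε ⟨i - 1, by omega⟩).1
  rcases he with rfl | rfl
  · exact h3.1 h2.symm
  · exact h3.2 h2.symm

/-- If the monodromy around `ρ_i` has an eigenvector with eigenvalue `±1`, then this eigenvector
is not a common eigenvector of `A_{i+1}, …, A_k`. -/
theorem VeryGeneric.exists_not_eigenvector_right (hgen : VeryGeneric c) (hc : ∀ i, c i ≠ 0)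
    (A : FramedLocalSystem c) {i : ℕ} (hi : i < n + 3) {v : Fin 2 → ℂ} (hv : v ≠ 0)
    {e : ℂ} (he : e = 1 ∨ e = -1) (h : (A.partialProd i).val *ᵥ v = e • v) :
    ∃ l : Fin (n + 3), i ≤ l ∧ ¬∃ b : ℂ, (A.mat l).val *ᵥ v = b • v := by
  by_contra! hcon
  obtain ⟨ε, hε⟩ := A.exists_signs hc hv (fun l => i ≤ l) hcon
  have h1 := A.partialProd_mulVec hi.le le_rfl h fun l hl _ => hε l hl
  rw [partialProd_all, Matrix.SpecialLinearGroup.coe_one, Matrix.one_mulVec] at h1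
  have hset : Finset.univ.filter (fun l : Fin (n + 3) => i ≤ (l : ℕ) ∧ l < n + 3) =
      Finset.Ici ⟨i, hi⟩ := by
    ext l
    simp only [Finset.mem_filter, Finset.mem_univ, true_and, Finset.mem_Ici, Fin.le_def]
    omega
  rw [hset] at h1
  nth_rewrite 1 [← one_smul ℂ v] at h1
  have h2 := smul_left_injective ℂ hv h1
  have h3 := (hgen ε ⟨i, hi⟩).2
  rcases he with rfl | rfl
  · exact h3.1 (by rw [h2, one_mul])
  · exact h3.2 (by rw [h2]; ring)

theorem VeryGeneric.exists_not_eigenvector (hgen : VeryGeneric c) (hc : ∀ i, c i ≠ 0)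
    (A : FramedLocalSystem c) {v : Fin 2 → ℂ} (hv : v ≠ 0) :
    ∃ l : Fin (n + 3), ¬∃ b : ℂ, (A.mat l).val *ᵥ v = b • v := by
  obtain ⟨l, -, hl⟩ := hgen.exists_not_eigenvector_right hc A (i := 0) (by omega) hv
    (Or.inl rfl) (by simp [partialProd_zero])
  exact ⟨l, hl⟩

end Irreducibility

/-! ### Slices of the conjugation action -/

section Slice

open Matrix ModuliSpace
open FramedLocalSystem hiding mk

variable {n : ℕ} {c : Fin (n + 3) → ℂ}

theorem FramedLocalSystem.exists_conj (A : FramedLocalSystem c) (g : SL2) :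
    ∃ B : FramedLocalSystem c, ModuliSpace.mk A = ModuliSpace.mk B ∧ ∀ l, B.mat l = g * A.mat l * g⁻¹ := by
  have h : (List.ofFn fun l => g * A.mat l * g⁻¹).prod = 1 := by
    have h1 := prod_take_ofFn_conj (M := A.mat) (M' := fun l => g * A.mat l * g⁻¹) g
      (Nat.zero_le (n + 3)) le_rfl
      (by rw [List.take_zero, List.take_zero, List.prod_nil, mul_one, mul_inv_cancel])
      fun _ _ _ => rfl
    rw [List.take_of_length_le (by simp), List.take_of_length_le (by simp), A.prod_eq_one,
      mul_one, mul_inv_cancel] at h1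
    exact h1
  refine ⟨A.twist (fun _ => g) h, mk_eq_mk_iff.mpr ⟨SpecialLinearGroup.toGL g, fun i => ?_⟩,
    fun l => rfl⟩
  rw [← map_inv]
  rfl

theorem IsEquivariantRegular.conj_SL2 {T : FramedLocalSystem c → SL2}
    (hT : IsEquivariantRegular fun A => (T A).val) {A B : FramedLocalSystem c} {g : SL2}
    (h : ∀ l, B.mat l = g * A.mat l * g⁻¹) : T B = g * T A * g⁻¹ := by
  have h1 := hT.conj A B (SpecialLinearGroup.toGL g) fun i => by
    rw [← map_inv, h i]
    rfl
  rw [← map_inv] at h1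
  exact Subtype.ext h1

/-- The framed local systems over `Z` for which the `μ`-eigenline of `T` is spanned by the first
basis vector and `A_m` sends the first basis vector to the second one. When the line is not
preserved by `A_m`, this condition determines the frame up to a scalar. -/
def normalizedSlice (Z : Set (ModuliSpace c)) (T : FramedLocalSystem c → SL2) (μ : ℂ)
    (m : Fin (n + 3)) : Set (FramedLocalSystem c) :=
  {A | mk A ∈ Z ∧ (T A).val 0 0 = μ ∧ (T A).val 1 0 = 0 ∧
    (A.mat m).val 0 0 = 0 ∧ (A.mat m).val 1 0 = 1}

variable {Z : Set (ModuliSpace c)} {T : FramedLocalSystem c → SL2} {μ : ℂ} {m : Fin (n + 3)}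

theorem lineDefect_smul_one (μ a : ℂ) (ha : a = μ ∨ a = μ⁻¹) (X : Matrix (Fin 2) (Fin 2) ℂ) :
    lineDefect (a • 1) μ X = 0 := by
  rcases ha with rfl | rfl <;> simp [lineDefect]

theorem ne_smul_one_of_lineDefect_ne_zero {T X : Matrix (Fin 2) (Fin 2) ℂ}
    (h : lineDefect T μ X ≠ 0) : T ≠ μ • 1 ∧ T ≠ μ⁻¹ • 1 :=
  ⟨fun e => h (e ▸ lineDefect_smul_one μ _ (Or.inl rfl) X),
    fun e => h (e ▸ lineDefect_smul_one μ _ (Or.inr rfl) X)⟩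

theorem exists_mem_normalizedSlice (hT : IsEquivariantRegular fun A => (T A).val) (hμ : μ ≠ 0)
    (htr : ∀ A, mk A ∈ Z → (T A).val.trace = μ + μ⁻¹)
    (hm : ∀ A, mk A ∈ Z → lineDefect (T A).val μ (A.mat m).val ≠ 0) {z : ModuliSpace c}
    (hz : z ∈ Z) : ∃ A ∈ normalizedSlice Z T μ m, mk A = z := by
  obtain ⟨A, rfl⟩ := exists_mk z
  have hne := ne_smul_one_of_lineDefect_ne_zero (hm A hz)
  obtain ⟨v, hv, hTv, -⟩ := exists_eigenvector hμ (htr A hz) hne.2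
  have hX := (lineDefect_eq_zero_iff hμ (htr A hz) hne.1 hne.2 hv hTv).not.mp (hm A hz)
  have hdet : v 0 * ((A.mat m).val *ᵥ v) 1 - ((A.mat m).val *ᵥ v) 0 * v 1 ≠ 0 :=
    fun h0 => hX (exists_eq_smul_of_det_eq_zero hv h0)
  -- rescale `v` so that `v` and `A_m v` form a frame of determinant `1`
  obtain ⟨s, hs⟩ := IsAlgClosed.exists_pow_nat_eq
    (v 0 * ((A.mat m).val *ᵥ v) 1 - ((A.mat m).val *ᵥ v) 0 * v 1)⁻¹ (n := 2) two_pos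
  obtain ⟨w, hw⟩ : ∃ w, w = s • v := ⟨_, rfl⟩
  have hTw : (T A).val *ᵥ w = μ • w := by rw [hw, Matrix.mulVec_smul, hTv, smul_comm]
  have hdet1 : (!![w 0, ((A.mat m).val *ᵥ w) 0; w 1, ((A.mat m).val *ᵥ w) 1]).det = 1 := by
    rw [Matrix.det_fin_two_of, hw, Matrix.mulVec_smul]
    simp only [Pi.smul_apply, smul_eq_mul]
    have := inv_mul_cancel₀ hdet
    rw [← hs] at this
    linear_combination this
  obtain ⟨g, hg⟩ : ∃ g : SL2, g.val = !![w 0, ((A.mat m).val *ᵥ w) 0; w 1,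
    ((A.mat m).val *ᵥ w) 1] := ⟨⟨_, hdet1⟩, rfl⟩
  obtain ⟨B, hAB, hB⟩ := A.exists_conj g⁻¹
  have hg0 : g.val *ᵥ ![1, 0] = w := by
    rw [hg]
    ext i
    fin_cases i <;> simp [Matrix.mulVec, dotProduct, Fin.sum_univ_two]
  have hg1 : g.val *ᵥ ![0, 1] = (A.mat m).val *ᵥ w := by
    rw [hg]
    ext i
    fin_cases i <;> simp
  have hcancel : ∀ x, (g⁻¹ : SL2).val *ᵥ (g.val *ᵥ x) = x := fun x => by
    rw [← SL2.val_mul_mulVec, inv_mul_cancel]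
    exact Matrix.one_mulVec x
  have hTB : (T B).val *ᵥ ![1, 0] = μ • ![1, 0] := by
    rw [hT.conj_SL2 hB, inv_inv, SL2.val_mul_mulVec, SL2.val_mul_mulVec, hg0, hTw, Matrix.mulVec_smul, ← hg0,
      hcancel]
  have hXB : (B.mat m).val *ᵥ ![1, 0] = ![0, 1] := by
    rw [hB, inv_inv, SL2.val_mul_mulVec, SL2.val_mul_mulVec, hg0, ← hg1, hcancel]
  refine ⟨B, ⟨hAB ▸ hz, ?_, ?_, ?_, ?_⟩, hAB.symm⟩
  · simpa [Matrix.mulVec, dotProduct, Fin.sum_univ_two] using congrFun hTB 0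
  · simpa [Matrix.mulVec, dotProduct, Fin.sum_univ_two] using congrFun hTB 1
  · simpa [Matrix.mulVec, dotProduct, Fin.sum_univ_two] using congrFun hXB 0
  · simpa [Matrix.mulVec, dotProduct, Fin.sum_univ_two] using congrFun hXB 1

/-- On the slice, the matrix entries are regular functions of the isomorphism class. Choose `A_j`
not preserving the `μ⁻¹`-eigenline of `T`; then `E = (T - μ⁻¹) A_j (T - μ)` is equivariant, and on
the slice it is a nonzero multiple of the elementary matrix with entry above the diagonal, so the
entries of any matrix `X` are quotients of traces of words in `E`, `A_m` and `X`. -/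
theorem exists_regular_entry (hgen : VeryGeneric c) (hc : ∀ i, c i ≠ 0)
    (hT : IsEquivariantRegular fun A => (T A).val) (hμ : μ ≠ 0)
    (htr : ∀ A, mk A ∈ Z → (T A).val.trace = μ + μ⁻¹)
    (hm : ∀ A, mk A ∈ Z → lineDefect (T A).val μ (A.mat m).val ≠ 0) {A : FramedLocalSystem c}
    (hA : A ∈ normalizedSlice Z T μ m) (l : Fin (n + 3)) (i j : Fin 2) :
    ∃ F : ModuliSpace c → ℂ, RegularAt F (mk A) ∧
      ∀ᶠ z in 𝓝 (mk A), ∀ B ∈ normalizedSlice Z T μ m, mk B = z → (B.mat l).val i j = F z := by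
  have hne := ne_smul_one_of_lineDefect_ne_zero (hm A hA.1)
  have htrA : (T A).val.trace = μ⁻¹ + μ⁻¹⁻¹ := by rw [htr A hA.1, inv_inv, add_comm]
  obtain ⟨v, hv, hTv, -⟩ := exists_eigenvector (inv_ne_zero hμ) htrA (by rw [inv_inv]; exact hne.1)
  obtain ⟨j₀, hj₀⟩ := hgen.exists_not_eigenvector hc A hv
  have hEA := (lineDefect_eq_zero_iff (inv_ne_zero hμ) htrA hne.2
    (by rw [inv_inv]; exact hne.1) hv hTv).not.mpr hj₀
  have hE := hT.lineDefect (IsEquivariantRegular.mat (c := c) j₀) μ⁻¹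
  have hM := IsEquivariantRegular.mat (c := c) m
  have hX := IsEquivariantRegular.mat (c := c) l
  obtain ⟨τ, hτ, hτ'⟩ := (hE.mul hM).exists_trace
  obtain ⟨F₁, hF₁, hF₁'⟩ := (hE.mul hX).exists_trace
  obtain ⟨F₂, hF₂, hF₂'⟩ := (hM.mul (hE.mul hX)).exists_trace
  obtain ⟨F₃, hF₃, hF₃'⟩ := (hM.mul (hE.mul (hM.mul hX))).exists_trace
  obtain ⟨F₄, hF₄, hF₄'⟩ := hX.exists_trace
  obtain ⟨F₅, hF₅, hF₅'⟩ := hM.exists_trace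
  have hshape : ∀ B ∈ normalizedSlice Z T μ m, ∃ t : ℂ,
      lineDefect (T B).val μ⁻¹ (B.mat j₀).val = !![0, t; 0, 0] := by
    intro B hB
    have hdet := (T B).2
    rw [Matrix.det_fin_two, hB.2.1, hB.2.2.1] at hdet
    have h11 : (T B).val 1 1 = μ⁻¹ := by
      field_simp
      linear_combination hdet
    have hTB : (T B).val = !![μ, (T B).val 0 1; 0, μ⁻¹] := by
      conv_lhs => rw [Matrix.eta_fin_two (T B).val, hB.2.1, hB.2.2.1, h11]
    refine ⟨lineDefect (T B).val μ⁻¹ (B.mat j₀).val 0 1, ?_⟩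
    ext i j
    fin_cases i <;> fin_cases j
    · show lineDefect (T B).val μ⁻¹ (B.mat j₀).val 0 0 = 0
      rw [lineDefect, hTB, inv_inv]
      simp [Matrix.mul_apply, Fin.sum_univ_two, Matrix.one_apply]
    · rfl
    · show lineDefect (T B).val μ⁻¹ (B.mat j₀).val 1 0 = 0
      rw [lineDefect, hTB, inv_inv]
      simp [Matrix.mul_apply, Fin.sum_univ_two, Matrix.one_apply]
    · show lineDefect (T B).val μ⁻¹ (B.mat j₀).val 1 1 = 0
      rw [lineDefect, hTB, inv_inv]
      simp [Matrix.mul_apply, Fin.sum_univ_two, Matrix.one_apply]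
  have hM' : ∀ B ∈ normalizedSlice Z T μ m, (B.mat m).val = !![0, -1; 1, (B.mat m).val 1 1] := by
    intro B hB
    have hdet := (B.mat m).2
    rw [Matrix.det_fin_two, hB.2.2.2.1, hB.2.2.2.2] at hdet
    ext i j
    fin_cases i <;> fin_cases j
    · exact hB.2.2.2.1
    · show (B.mat m).val 0 1 = -1
      linear_combination -hdet
    · exact hB.2.2.2.2
    · rfl
  have hτB : ∀ B ∈ normalizedSlice Z T μ m,
      lineDefect (T B).val μ⁻¹ (B.mat j₀).val = !![0, τ (mk B); 0, 0] := by
    intro B hB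
    obtain ⟨t, ht⟩ := hshape B hB
    rw [hτ', ht, hM' B hB]
    simp [Matrix.trace_fin_two]
  have hτA : τ (mk A) ≠ 0 := by
    intro h0
    apply hEA
    rw [hτB A hA, h0]
    ext i j
    fin_cases i <;> fin_cases j <;> rfl
  have hr := (hF₁ (mk A)).div (hτ _) hτA
  have hs := (hF₂ (mk A)).div (hτ _) hτA
  have hp := (hF₄ (mk A)).sub hs
  have hq := ((hF₃ (mk A)).div (hτ _) hτA).sub ((hF₅ (mk A)).mul hs)
  have hev := (hτ (mk A)).eventually_ne hτA
  have hentry : ∀ B ∈ normalizedSlice Z T μ m, τ (mk B) ≠ 0 →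
      F₁ (mk B) / τ (mk B) = (B.mat l).val 1 0 ∧ F₂ (mk B) / τ (mk B) = (B.mat l).val 1 1 ∧
      F₃ (mk B) / τ (mk B) = (B.mat l).val 0 1 + (B.mat m).val 1 1 * (B.mat l).val 1 1 := by
    intro B hB h0
    rw [hF₁', hF₂', hF₃', hτB B hB]
    generalize τ (mk B) = t at h0
    have h1 := hM' B hB
    generalize (B.mat m).val = M at h1 ⊢
    generalize (B.mat l).val = X
    rw [h1, Matrix.eta_fin_two X]
    refine ⟨?_, ?_, ?_⟩
    · simp [Matrix.trace_fin_two, h0]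
    · simp [Matrix.trace_fin_two, h0]
    · simp [Matrix.trace_fin_two]
      field_simp
  have hF₄B : ∀ B : FramedLocalSystem c, F₄ (mk B) = (B.mat l).val 0 0 + (B.mat l).val 1 1 :=
    fun B => by rw [hF₄', Matrix.trace_fin_two]
  have hF₅B : ∀ B ∈ normalizedSlice Z T μ m, F₅ (mk B) = (B.mat m).val 1 1 :=
    fun B hB => by rw [hF₅', Matrix.trace_fin_two, hB.2.2.2.1, zero_add]
  fin_cases i <;> fin_cases j
  · refine ⟨_, hp, ?_⟩
    filter_upwards [hev] with z hz B hB hBz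
    subst hBz
    rw [(hentry B hB hz).2.1, hF₄B]
    simp
  · refine ⟨_, hq, ?_⟩
    filter_upwards [hev] with z hz B hB hBz
    subst hBz
    rw [(hentry B hB hz).2.1, (hentry B hB hz).2.2, hF₅B B hB]
    simp
  · refine ⟨_, hr, ?_⟩
    filter_upwards [hev] with z hz B hB hBz
    subst hBz
    rw [(hentry B hB hz).1]
    rfl
  · refine ⟨_, hs, ?_⟩
    filter_upwards [hev] with z hz B hB hBz
    subst hBz
    rw [(hentry B hB hz).2.1]
    rfl

theorem normalizedSlice_injective (hgen : VeryGeneric c) (hc : ∀ i, c i ≠ 0)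
    (hT : IsEquivariantRegular fun A => (T A).val) (hμ : μ ≠ 0)
    (htr : ∀ A, mk A ∈ Z → (T A).val.trace = μ + μ⁻¹)
    (hm : ∀ A, mk A ∈ Z → lineDefect (T A).val μ (A.mat m).val ≠ 0) {A B : FramedLocalSystem c}
    (hA : A ∈ normalizedSlice Z T μ m) (hB : B ∈ normalizedSlice Z T μ m) (h : mk A = mk B) :
    A = B := by
  refine ext_mat fun l => Subtype.ext (Matrix.ext fun i j => ?_)
  obtain ⟨F, -, hF⟩ := exists_regular_entry hgen hc hT hμ htr hm hA l i j
  have h1 := hF.self_of_nhds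
  exact (h1 A hA rfl).trans (h1 B hB h.symm).symm

end Slice

/-! ### Unipotent flows and affine line factors -/

section Flow

open Matrix ModuliSpace
open FramedLocalSystem hiding mk

variable {n : ℕ} {c : Fin (n + 3) → ℂ}

theorem RegularFunctions.RegularAt.upperUnipotent_conj {X : Type*} [TopologicalSpace X]
    [RegularFunctions X] [HasRegularCalculus X] {t : X → ℂ} {A : X → SL2} {x : X}
    (ht : RegularAt t x) (hA : ∀ i j, RegularAt (fun y => (A y).val i j) x) (i j : Fin 2) :
    RegularAt (fun y => (upperUnipotent (t y) * A y * (upperUnipotent (t y))⁻¹).val i j) x := by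
  simp only [_root_.upperUnipotent_conj]
  fin_cases i <;> fin_cases j
  · exact (hA 0 0).add (ht.mul (hA 1 0))
  · exact ((hA 0 1).add (ht.mul (hA 1 1))).sub (ht.mul ((hA 0 0).add (ht.mul (hA 1 0))))
  · exact hA 1 0
  · exact (hA 1 1).sub (ht.mul (hA 1 0))

/-- The affine coordinates of a framed local system, numbered by an initial segment of `ℕ`. -/
noncomputable def coordinates (A : FramedLocalSystem c) :
    ComplexAffineSpace (Fin (Fintype.card (Fin (n + 3) × Fin 2 × Fin 2))) :=
  ⟨fun i => A.entries.coord ((Fintype.equivFin _).symm i)⟩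

theorem coordinates_coord (A : FramedLocalSystem c) (l : Fin (n + 3)) (i j : Fin 2) :
    (coordinates A).coord (Fintype.equivFin _ (l, i, j)) = (A.mat l).val i j := by
  simp [coordinates, entries]

theorem coordinates_injective :
    Function.Injective (coordinates (c := c)) := by
  intro A B h
  refine ext_mat fun l => Subtype.ext (Matrix.ext fun i j => ?_)
  rw [← coordinates_coord A, ← coordinates_coord B, h]

theorem isClosedEmbedding_coordinates (hc : ∀ i, c i ≠ 0 ∧ c i ≠ 1 ∧ c i ≠ -1) :
    Topology.IsClosedEmbedding (coordinates (c := c)) := by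
  let ι := Fin (n + 3) × Fin 2 × Fin 2
  let κ : ComplexAffineSpace ι ≃ₜ ComplexAffineSpace (Fin (Fintype.card ι)) :=
    { toFun := fun x => ⟨fun i => x.coord ((Fintype.equivFin ι).symm i)⟩
      invFun := fun x => ⟨fun i => x.coord (Fintype.equivFin ι i)⟩
      left_inv := fun x => by simp
      right_inv := fun x => by simp
      continuous_toFun :=
        (isMorphism_of_coord (φ := fun x : ComplexAffineSpace ι =>
          (⟨fun i => x.coord ((Fintype.equivFin ι).symm i)⟩ : ComplexAffineSpace _))
          fun i x => ComplexAffineSpace.regularAt_coord _ x).1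
      continuous_invFun :=
        (isMorphism_of_coord (φ := fun x : ComplexAffineSpace (Fin (Fintype.card ι)) =>
          (⟨fun i => x.coord (Fintype.equivFin ι i)⟩ : ComplexAffineSpace ι))
          fun i x => ComplexAffineSpace.regularAt_coord _ x).1 }
  have hinj : Function.Injective (entries (c := c)) := by
    intro A B h
    refine coordinates_injective ?_
    simp only [coordinates, h]
  exact κ.isClosedEmbedding.comp
    ⟨⟨isInducing_entries, hinj⟩, FramedLocalSystem.isClosed_range_entries hc⟩

theorem isLocallyClosed_normalizedSlice {Z : Set (ModuliSpace c)} (hZ : IsLocallyClosed Z)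
    {T : FramedLocalSystem c → SL2} (hT : IsEquivariantRegular fun A => (T A).val) (μ : ℂ)
    (m : Fin (n + 3)) : IsLocallyClosed (normalizedSlice Z T μ m) :=
  (hZ.preimage isMorphism_mk.1).inter
    ((RegularFunctions.isClosed_setOf_eq (fun A => hT.regular 0 0 A) μ).inter
      ((RegularFunctions.isClosed_setOf_eq (fun A => hT.regular 1 0 A) 0).inter
        ((RegularFunctions.isClosed_setOf_eq (fun A => regularAt_mat m 0 0 A) 0).inter
          (RegularFunctions.isClosed_setOf_eq
            (fun A => regularAt_mat m 1 0 A) 1)))).isLocallyClosed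

/-- A locally closed subset of the moduli space has an affine line factor as soon as the
normalized slice over it carries a flow, conjugating each matrix by a unipotent matrix, and a
regular function `f` that increases at unit speed along the flow: the slice is then the product of
the zero set of `f` and the line. -/
theorem isProductWithAffineLine_of_flow (hgen : VeryGeneric c)
    (hc : ∀ i, c i ≠ 0 ∧ c i ≠ 1 ∧ c i ≠ -1) {Z : Set (ModuliSpace c)} (hZ : IsLocallyClosed Z)
    {T : FramedLocalSystem c → SL2} (hT : IsEquivariantRegular fun A => (T A).val) {μ : ℂ}
    (hμ : μ ≠ 0) {m : Fin (n + 3)} (htr : ∀ A, mk A ∈ Z → (T A).val.trace = μ + μ⁻¹)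
    (hm : ∀ A, mk A ∈ Z → lineDefect (T A).val μ (A.mat m).val ≠ 0)
    (γ : Fin (n + 3) → FramedLocalSystem c → ℂ) (f : FramedLocalSystem c → ℂ)
    (hγ : ∀ l, ∀ A ∈ normalizedSlice Z T μ m, RegularAt (γ l) A)
    (hf : ∀ A ∈ normalizedSlice Z T μ m, RegularAt f A)
    (hflow : ∀ A ∈ normalizedSlice Z T μ m, ∀ x : ℂ, ∃ B ∈ normalizedSlice Z T μ m,
      (∀ l, B.mat l = upperUnipotent (x * γ l A) * A.mat l * (upperUnipotent (x * γ l A))⁻¹) ∧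
      (∀ l, γ l B = γ l A) ∧ f B = f A + x) :
    IsProductWithAffineLine Z := by
  have hc0 : ∀ i, c i ≠ 0 := fun i => (hc i).1
  obtain ⟨W, hW⟩ : ∃ W, W = normalizedSlice Z T μ m := ⟨_, rfl⟩
  have hWmem : ∀ {A}, A ∈ W → A ∈ normalizedSlice Z T μ m := fun hA => hW ▸ hA
  have hWZ : ∀ A ∈ W, mk A ∈ Z := fun A hA => (hWmem hA).1
  have hWlc : IsLocallyClosed W := hW ▸ isLocallyClosed_normalizedSlice hZ hT μ m
  have hinj : ∀ A ∈ W, ∀ B ∈ W, mk A = mk B → A = B := fun A hA B hB h =>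
    normalizedSlice_injective hgen hc0 hT hμ htr hm (hWmem hA) (hWmem hB) h
  have hsurj : ∀ z : Z, ∃ A : W, mk A.1 = z.1 := fun z => by
    obtain ⟨A, hA, h⟩ := exists_mem_normalizedSlice hT hμ htr hm z.2
    exact ⟨⟨A, hW ▸ hA⟩, h⟩
  choose N hN using hsurj
  have hNreg : ∀ l i j (z : Z), RegularAt (fun z : Z => ((N z).1.mat l).val i j) z := by
    intro l i j z
    obtain ⟨F, hF, hF'⟩ := exists_regular_entry hgen hc0 hT hμ htr hm (hWmem (N z).2) l i j
    rw [hN z] at hF hF'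
    refine ⟨F, hF, ?_⟩
    filter_upwards [continuous_subtype_val.continuousAt.eventually hF'] with z' hz'
    exact hz' _ (hWmem (N z').2) (hN z')
  rw [← hW] at hγ hf hflow
  have hflow' : ∀ (A : W) (x : ℂ), ∃ B : W,
      (∀ l, B.1.mat l = upperUnipotent (x * γ l A.1) * A.1.mat l *
        (upperUnipotent (x * γ l A.1))⁻¹) ∧
      (∀ l, γ l B.1 = γ l A.1) ∧ f B.1 = f A.1 + x := fun A x => by
    obtain ⟨B, hB, h⟩ := hflow A.1 A.2 x
    exact ⟨⟨B, hB⟩, h⟩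
  choose φ hφmat hφγ hφf using hflow'
  have hφadd : ∀ A x y, φ (φ A x) y = φ A (x + y) := fun A x y =>
    Subtype.ext (ext_mat fun l => by
      rw [hφmat, hφmat, hφmat, hφγ, upperUnipotent_conj_add, ← add_mul, add_comm y x])
  have hφzero : ∀ A, φ A 0 = A := fun A => Subtype.ext (ext_mat fun l => by
    rw [hφmat, zero_mul, upperUnipotent_zero, one_mul, inv_one, mul_one])
  have hNmor : IsMorphism fun z : Z => (N z).1 :=
    isMorphism_of_mat fun l i j z => hNreg l i j z
  obtain ⟨Y, hY⟩ : ∃ Y, Y = coordinates '' {A : FramedLocalSystem c | A ∈ W ∧ f A = 0} := ⟨_, rfl⟩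
  have hYlc : IsLocallyClosed Y := by
    have h0 : IsClosed {A : W | f A.1 = 0} :=
      RegularFunctions.isClosed_setOf_eq_zero fun A =>
        (isMorphism_subtype_val W).2 A f (hf A.1 A.2)
    have h1 : IsLocallyClosed {A : FramedLocalSystem c | A ∈ W ∧ f A = 0} := by
      have h2 := h0.isLocallyClosed.image Topology.IsInducing.subtypeVal (by simpa using hWlc)
      convert h2 using 1
      ext A
      constructor
      · rintro ⟨hA, hA'⟩
        exact ⟨⟨A, hA⟩, hA', rfl⟩
      · rintro ⟨B, hB, rfl⟩
        exact ⟨B.2, hB⟩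
    have hemb := isClosedEmbedding_coordinates hc
    exact hY ▸ h1.image hemb.isInducing hemb.isClosed_range.isLocallyClosed
  have hYa : ∀ y : timesAffineLine Y, ∃ A : W, f A.1 = 0 ∧
      ∀ i, (coordinates A.1).coord i = y.1.coord i.castSucc := fun y => by
    have hy : (⟨fun i => y.1.coord i.castSucc⟩ : ComplexAffineSpace _) ∈ Y := y.2
    obtain ⟨A, ⟨hA, hA'⟩, h⟩ := hY.subset hy
    exact ⟨⟨A, hA⟩, hA', fun i => by rw [h]⟩
  choose a haf hac using hYa
  have hamor : IsMorphism fun y => (a y).1 := by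
    refine isMorphism_of_mat fun l i j y => ?_
    simp only [← coordinates_coord, hac]
    exact (isMorphism_subtype_val _).2 y _ (ComplexAffineSpace.regularAt_coord _ _)
  have hpt : ∀ z : Z, (⟨Fin.snoc (α := fun _ => ℂ)
      (coordinates (φ (N z) (-f (N z).1)).1).coord (f (N z).1)⟩ : ComplexAffineSpace _) ∈
      timesAffineLine Y := fun z => by
    rw [hY]
    exact ⟨_, ⟨(φ (N z) (-f (N z).1)).2, by rw [hφf, add_neg_cancel]⟩, by simp⟩
  let e : Z ≃ timesAffineLine Y :=
    { toFun := fun z => ⟨_, hpt z⟩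
      invFun := fun y => ⟨mk (φ (a y) (y.1.coord (Fin.last _))).1, hWZ _ (Subtype.prop _)⟩
      left_inv := fun z => by
        have h1 : a ⟨_, hpt z⟩ = φ (N z) (-f (N z).1) := by
          apply Subtype.ext
          apply coordinates_injective
          have h2 := hac ⟨_, hpt z⟩
          simp only [Fin.snoc_castSucc] at h2
          exact congrArg ComplexAffineSpace.mk (funext h2)
        apply Subtype.ext
        simp only [h1, Fin.snoc_last, hφadd, neg_add_cancel, hφzero, hN]
      right_inv := fun y => by
        obtain ⟨z, hz⟩ : ∃ z : Z, z = ⟨mk (φ (a y) (y.1.coord (Fin.last _))).1,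
          hWZ _ (Subtype.prop _)⟩ := ⟨_, rfl⟩
        have h1 : N z = φ (a y) (y.1.coord (Fin.last _)) :=
          Subtype.ext (hinj _ (N z).2 _ (Subtype.prop _) (by rw [hN, hz]))
        have h2 : f (N z).1 = y.1.coord (Fin.last _) := by rw [h1, hφf, haf, zero_add]
        apply Subtype.ext
        simp only [← hz]
        rw [h2, h1, hφadd, add_neg_cancel, hφzero]
        refine congrArg ComplexAffineSpace.mk (funext fun i => ?_)
        refine Fin.lastCases ?_ (fun i => ?_) i
        · rw [Fin.snoc_last]
        · rw [Fin.snoc_castSucc, hac] }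
  refine ⟨_, Y, hYlc, e, ?_, ?_⟩
  · refine IsMorphism.subtype_mk (isMorphism_of_coord fun i z => ?_) hpt
    have hfN : RegularAt (fun z : Z => f (N z).1) z := hNmor.2 z f (hf _ (N z).2)
    refine Fin.lastCases ?_ (fun i => ?_) i
    · simpa only [Fin.snoc_last] using hfN
    · simp only [Fin.snoc_castSucc]
      obtain ⟨⟨l, i, j⟩, rfl⟩ := (Fintype.equivFin (Fin (n + 3) × Fin 2 × Fin 2)).surjective i
      simp only [coordinates_coord, hφmat]
      exact (hfN.neg.mul (hNmor.2 z (γ l) (hγ l _ (N z).2))).upperUnipotent_conj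
        (fun i j => hNreg l i j z) i j
  · refine IsMorphism.subtype_mk (φ := fun y => mk (φ (a y) (y.1.coord (Fin.last _))).1)
      (isMorphism_mk.comp (isMorphism_of_mat fun l i j y => ?_)) _
    simp only [hφmat]
    have hlast : RegularAt (fun y : timesAffineLine Y => y.1.coord (Fin.last _)) y :=
      (isMorphism_subtype_val _).2 y _ (ComplexAffineSpace.regularAt_coord _ _)
    exact (hlast.mul (hamor.2 y (γ l) (hγ l _ (a y).2))).upperUnipotent_conj
      (fun i j => hamor.2 y _ (regularAt_mat l i j _)) i j

end Flow

/-! ### Monodromy of trace `±2` around a cutting circle -/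

section Bad

open Matrix ModuliSpace
open FramedLocalSystem hiding mk

variable {n : ℕ} {c : Fin (n + 3) → ℂ}

/-- The isomorphism classes for which the `l`-th matrix preserves the `μ`-eigenline of `T`; for
`l` beyond the number of matrices the condition is void. -/
def preservingLocus (T : FramedLocalSystem c → SL2) (μ : ℂ) (l : ℕ) : Set (ModuliSpace c) :=
  locus fun A => ∀ h : l < n + 3, lineDefect (T A).val μ (A.mat ⟨l, h⟩).val = 0

variable {T : FramedLocalSystem c → SL2} {μ : ℂ}

theorem mk_mem_preservingLocus (hT : IsEquivariantRegular fun A => (T A).val)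
    {A : FramedLocalSystem c} {l : ℕ} : mk A ∈ preservingLocus T μ l ↔
      ∀ h : l < n + 3, lineDefect (T A).val μ (A.mat ⟨l, h⟩).val = 0 :=
  mk_mem_locus fun _ _ h hA hl =>
    ((hT.lineDefect (IsEquivariantRegular.mat ⟨l, hl⟩) μ).eq_zero_iff h).mp (hA hl)

theorem isClosed_preservingLocus (hT : IsEquivariantRegular fun A => (T A).val) (l : ℕ) :
    IsClosed (preservingLocus T μ l) := by
  refine isClosed_locus (fun _ _ h hA hl =>
    ((hT.lineDefect (IsEquivariantRegular.mat ⟨l, hl⟩) μ).eq_zero_iff h).mp (hA hl)) ?_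
  by_cases hl : l < n + 3
  · simpa [hl] using
      (hT.lineDefect (IsEquivariantRegular.mat (c := c) ⟨l, hl⟩) μ).isClosed_setOf_eq_zero
  · simp [hl]

theorem isClosed_setOf_forall_lt {X : Type*} [TopologicalSpace X] {C : ℕ → Set X}
    (hC : ∀ l, IsClosed (C l)) (m : ℕ) : IsClosed {x | ∀ l < m, x ∈ C l} := by
  have h : {x | ∀ l < m, x ∈ C l} = ⋂ l, ⋂ _ : l < m, C l := by
    ext x
    simp
  rw [h]
  exact isClosed_iInter fun l => isClosed_iInter fun _ => hC l

theorem mulVec_single_zero {X : Matrix (Fin 2) (Fin 2) ℂ} {a : ℂ} (h0 : X 0 0 = a)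
    (h1 : X 1 0 = 0) : X *ᵥ ![1, 0] = a • ![1, 0] := by
  ext i
  fin_cases i <;> simp [Matrix.mulVec, dotProduct, Fin.sum_univ_two, h0, h1]

/-- Conjugating each matrix by an upper unipotent matrix does not change which of them preserve
the line spanned by the first basis vector. -/
theorem mk_mem_preservingLocus_congr (hT : IsEquivariantRegular fun A => (T A).val) (hμ : μ ≠ 0)
    {A B : FramedLocalSystem c} {t : Fin (n + 3) → ℂ}
    (hB : ∀ l, B.mat l = upperUnipotent (t l) * A.mat l * (upperUnipotent (t l))⁻¹)
    (hA : (T A).val ≠ μ • 1 ∧ (T A).val ≠ μ⁻¹ • 1) (hB' : (T B).val ≠ μ • 1 ∧ (T B).val ≠ μ⁻¹ • 1)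
    (hA0 : (T A).val 0 0 = μ) (hA1 : (T A).val 1 0 = 0)
    (hB0 : (T B).val 0 0 = μ) (hB1 : (T B).val 1 0 = 0) (l : ℕ) :
    mk B ∈ preservingLocus T μ l ↔ mk A ∈ preservingLocus T μ l := by
  rw [mk_mem_preservingLocus hT, mk_mem_preservingLocus hT]
  refine forall_congr' fun hl => ?_
  rw [lineDefect_eq_zero_iff_of_upper hμ hA.1 hA.2 hA0 hA1,
    lineDefect_eq_zero_iff_of_upper hμ hB'.1 hB'.2 hB0 hB1, hB, upperUnipotent_conj]
  rfl

theorem mk_not_mem_preservingLocus (hT : IsEquivariantRegular fun A => (T A).val) (hμ : μ ≠ 0)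
    {A : FramedLocalSystem c} (htr : (T A).val.trace = μ + μ⁻¹)
    (hne : (T A).val ≠ μ • 1 ∧ (T A).val ≠ μ⁻¹ • 1) {v : Fin 2 → ℂ} (hv : v ≠ 0)
    (hTv : (T A).val *ᵥ v = μ • v) {l : Fin (n + 3)}
    (hl : ¬∃ b : ℂ, (A.mat l).val *ᵥ v = b • v) : mk A ∉ preservingLocus T μ l := fun h =>
  hl ((lineDefect_eq_zero_iff hμ htr hne.1 hne.2 hv hTv).mp
    ((mk_mem_preservingLocus hT).mp h l.2))

/-- Suppose that `A₁ ⋯ A_i` acts as `±1` on the `μ`-eigenline of a matrix `T` that depends only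
on `A₁, …, A_i`, and that this line is preserved neither by `A_m` nor by `A_r`, where `m ≤ i < r`.
Conjugating `A_{i+1}, …, A_k` by the unipotent matrices that fix the line gives a flow, and if `Z`
is stable under this flow it has an affine line factor. -/
theorem isProductWithAffineLine_of_eigenline_left (hgen : VeryGeneric c)
    (hc : ∀ i, c i ≠ 0 ∧ c i ≠ 1 ∧ c i ≠ -1) {Z : Set (ModuliSpace c)} (hZlc : IsLocallyClosed Z)
    {i : ℕ} (hi : i ≤ n + 3) (hT : IsEquivariantRegular fun A => (T A).val) (hμ : μ ≠ 0)
    (hTleft : ∀ A B : FramedLocalSystem c, (∀ l : Fin (n + 3), l < i → B.mat l = A.mat l) →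
      T B = T A)
    (htr : ∀ A, mk A ∈ Z → (T A).val.trace = μ + μ⁻¹)
    (hne : ∀ A, mk A ∈ Z → (T A).val ≠ μ • 1 ∧ (T A).val ≠ μ⁻¹ • 1) {e : ℂ}
    (he : e = 1 ∨ e = -1)
    (hB : ∀ A, mk A ∈ Z → ∀ v, (T A).val *ᵥ v = μ • v → (A.partialProd i).val *ᵥ v = e • v)
    {m r : Fin (n + 3)} (hm : m < i) (hr : i ≤ r)
    (hZm : ∀ A, mk A ∈ Z → mk A ∉ preservingLocus T μ m)
    (hZr : ∀ A, mk A ∈ Z → mk A ∉ preservingLocus T μ r)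
    (hZ : ∀ A B : FramedLocalSystem c, mk A ∈ Z →
      (∀ l : Fin (n + 3), l < i → B.mat l = A.mat l) →
      (∀ l, mk B ∈ preservingLocus T μ l ↔ mk A ∈ preservingLocus T μ l) → mk B ∈ Z) :
    IsProductWithAffineLine Z := by
  have hmdef : ∀ A, mk A ∈ Z → lineDefect (T A).val μ (A.mat m).val ≠ 0 := by
    intro A hA h0
    have h1 := hZm A hA
    rw [mk_mem_preservingLocus hT] at h1
    exact h1 fun _ => h0
  have hrdef : ∀ A ∈ normalizedSlice Z T μ m, (A.mat r).val 1 0 ≠ 0 := by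
    intro A hA h0
    have h1 := hZr A hA.1
    rw [mk_mem_preservingLocus hT] at h1
    have h2 := hne A hA.1
    exact h1 fun _ => (lineDefect_eq_zero_iff_of_upper hμ h2.1 h2.2 hA.2.1 hA.2.2.1).mpr h0
  refine isProductWithAffineLine_of_flow hgen hc hZlc hT hμ (m := m) htr hmdef
    (fun l _ => if (l : ℕ) < i then 0 else 1)
    (fun A => (A.mat r).val 0 0 / (A.mat r).val 1 0)
    (fun l A _ => RegularFunctions.RegularAt.const _ A)
    (fun A hA => (regularAt_mat _ 0 0 A).div (regularAt_mat _ 1 0 A) (hrdef A hA)) ?_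
  intro A hA x
  let g : Fin (n + 3) → SL2 := fun l => upperUnipotent (x * if (l : ℕ) < i then 0 else 1)
  have hgl : ∀ l : Fin (n + 3), l < i → g l = 1 := fun l hl => by
    simp only [g, hl, if_true, mul_zero, upperUnipotent_zero]
  have hgr : ∀ l : Fin (n + 3), i ≤ l → g l = upperUnipotent x := fun l hl => by
    simp only [g, not_lt.mpr hl, if_false, mul_one]
  -- the flow commutes with `A₁ ⋯ A_i`, which is upper triangular with diagonal entries `e = ±1`
  have hpp := hB A hA.1 _ (mulVec_single_zero hA.2.1 hA.2.2.1)
  have hp0 : (A.partialProd i).val 0 0 = e := by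
    simpa [Matrix.mulVec, dotProduct, Fin.sum_univ_two] using congrFun hpp 0
  have hp1 : (A.partialProd i).val 1 0 = 0 := by
    simpa [Matrix.mulVec, dotProduct, Fin.sum_univ_two] using congrFun hpp 1
  have hdet := (A.partialProd i).2
  rw [Matrix.det_fin_two, hp0, hp1, mul_zero, sub_zero] at hdet
  have hp2 : (A.partialProd i).val 1 1 = e := by
    rcases he with rfl | rfl
    · linear_combination hdet
    · linear_combination -hdet
  have hcomm : upperUnipotent x * A.partialProd i * (upperUnipotent x)⁻¹ = A.partialProd i := by
    apply Subtype.ext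
    rw [upperUnipotent_conj, hp0, hp1, hp2]
    conv_rhs => rw [Matrix.eta_fin_two (A.partialProd i).val, hp0, hp1, hp2]
    ext i j
    fin_cases i <;> fin_cases j <;> simp
  have hleft := prod_take_ofFn_conj (M := A.mat) (M' := fun l => g l * A.mat l * (g l)⁻¹) 1
    (Nat.zero_le i) hi (by rw [List.take_zero, List.take_zero, List.prod_nil, mul_one, inv_one,
      mul_one]) fun l _ hl => by rw [hgl l hl]
  have hall := prod_take_ofFn_conj (M := A.mat) (M' := fun l => g l * A.mat l * (g l)⁻¹)
    (upperUnipotent x) hi le_rfl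
    (by
      rw [hleft, one_mul, inv_one, mul_one]
      exact hcomm.symm)
    fun l hl _ => by rw [hgr l hl]
  rw [List.take_of_length_le (by simp), List.take_of_length_le (by simp), A.prod_eq_one, mul_one,
    mul_inv_cancel] at hall
  have hBmat : ∀ l, (A.twist g hall).mat l = g l * A.mat l * (g l)⁻¹ := fun l => rfl
  generalize A.twist g hall = B at hBmat
  have hBl : ∀ l : Fin (n + 3), l < i → B.mat l = A.mat l := fun l hl => by
    rw [hBmat, hgl l hl, one_mul, inv_one, mul_one]
  have hTB := hTleft A B hBl
  have hneA := hne A hA.1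
  have hCB : ∀ l, mk B ∈ preservingLocus T μ l ↔ mk A ∈ preservingLocus T μ l :=
    fun l => mk_mem_preservingLocus_congr hT hμ hBmat hneA (hTB ▸ hneA) hA.2.1 hA.2.2.1
      (hTB ▸ hA.2.1) (hTB ▸ hA.2.2.1) l
  have hBm := hBl m hm
  refine ⟨B, ⟨hZ A B hA.1 hBl hCB, hTB ▸ hA.2.1, hTB ▸ hA.2.2.1, hBm ▸ hA.2.2.2.1,
    hBm ▸ hA.2.2.2.2⟩, hBmat, fun l => rfl, ?_⟩
  have h1 := hrdef A hA
  rw [hBmat r, hgr r hr, upperUnipotent_conj]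
  simp only [Matrix.of_apply, Matrix.cons_val', Matrix.cons_val_zero, Matrix.cons_val_one,
    Matrix.cons_val_fin_one]
  field_simp

theorem mem_diff_chain_iff {X : Type*} {F D : Set X} {C C' : ℕ → Set X} {m r : ℕ} {z : X} :
    z ∈ (D ∩ {x | ∀ l < m, x ∈ C l} ∩ {x | ∀ l < r, x ∈ C' l}) \
      (F ∪ D ∩ {x | ∀ l < m + 1, x ∈ C l} ∪
        D ∩ {x | ∀ l < m, x ∈ C l} ∩ {x | ∀ l < r + 1, x ∈ C' l}) ↔
    z ∈ D \ F ∧ (∀ l < m, z ∈ C l) ∧ z ∉ C m ∧ (∀ l < r, z ∈ C' l) ∧ z ∉ C' r := by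
  have h1 : (∀ l < m + 1, z ∈ C l) ↔ (∀ l < m, z ∈ C l) ∧ z ∈ C m := Nat.forall_lt_succ_right
  have h2 : (∀ l < r + 1, z ∈ C' l) ↔ (∀ l < r, z ∈ C' l) ∧ z ∈ C' r :=
    Nat.forall_lt_succ_right
  have taut : ∀ d f p q s t : Prop, ((d ∧ p) ∧ s) ∧ ¬((f ∨ d ∧ p ∧ q) ∨ (d ∧ p) ∧ s ∧ t) ↔
      (d ∧ ¬f) ∧ p ∧ ¬q ∧ s ∧ ¬t := by
    intros
    tauto
  show ((z ∈ D ∧ ∀ l < m, z ∈ C l) ∧ ∀ l < r, z ∈ C' l) ∧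
    ¬((z ∈ F ∨ z ∈ D ∧ ∀ l < m + 1, z ∈ C l) ∨
      (z ∈ D ∧ ∀ l < m, z ∈ C l) ∧ ∀ l < r + 1, z ∈ C' l) ↔ _
  rw [h1, h2]
  exact taut _ _ _ _ _ _

/-- Let `D \ F` be a locus defined by conditions on `A₁, …, A_i`, on which `A₁ ⋯ A_i` acts as `±1`
on the `μ`-eigenline of a matrix `T` that depends only on `A₁, …, A_i`. Then `D \ F` can be
filtered by pieces with an affine line factor, according to the first matrices on both sides of
`ρ_i` that do not preserve the line; they exist because of very genericity. -/
theorem ClosedFiltration.union_of_eigenline_left (hgen : VeryGeneric c)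
    (hc : ∀ i, c i ≠ 0 ∧ c i ≠ 1 ∧ c i ≠ -1) {P : Set (ModuliSpace c) → Prop}
    {F D : Set (ModuliSpace c)} (hF : ClosedFiltration P F) (hD : IsClosed D)
    (hP : ∀ Z ⊆ D \ F, IsProductWithAffineLine Z → P Z) {i : ℕ} (hi1 : 1 ≤ i) (hi : i < n + 3)
    (hT : IsEquivariantRegular fun A => (T A).val) (hμ : μ ≠ 0)
    (hDF : ∀ A B : FramedLocalSystem c, (∀ l : Fin (n + 3), l < i → B.mat l = A.mat l) →
      mk A ∈ D \ F → mk B ∈ D \ F)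
    (hTleft : ∀ A B : FramedLocalSystem c, (∀ l : Fin (n + 3), l < i → B.mat l = A.mat l) →
      T B = T A)
    (htr : ∀ A, mk A ∈ D \ F → (T A).val.trace = μ + μ⁻¹)
    (hne : ∀ A, mk A ∈ D \ F → (T A).val ≠ μ • 1 ∧ (T A).val ≠ μ⁻¹ • 1) {e : ℂ}
    (he : e = 1 ∨ e = -1)
    (hB : ∀ A, mk A ∈ D \ F → ∀ v, (T A).val *ᵥ v = μ • v → (A.partialProd i).val *ᵥ v = e • v) :
    ClosedFiltration P (F ∪ D) := by
  have hc0 : ∀ i, c i ≠ 0 := fun i => (hc i).1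
  obtain ⟨C, hC⟩ : ∃ C, C = preservingLocus T μ := ⟨_, rfl⟩
  have hCcl : ∀ l, IsClosed (C l) := fun l => hC ▸ isClosed_preservingLocus hT l
  have hnon : ∀ A, mk A ∈ D \ F → (∃ l < i, mk A ∉ C l) ∧ ∃ l, i ≤ l ∧ l < n + 3 ∧ mk A ∉ C l := by
    intro A hA
    obtain ⟨v, hv, hTv, -⟩ := exists_eigenvector hμ (htr A hA) (hne A hA).2
    obtain ⟨l, hl, hl'⟩ :=
      hgen.exists_not_eigenvector_left hc0 A hi1 hi.le hv he (hB A hA v hTv)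
    obtain ⟨r, hr, hr'⟩ :=
      hgen.exists_not_eigenvector_right hc0 A hi hv he (hB A hA v hTv)
    rw [hC]
    exact ⟨⟨l, hl, mk_not_mem_preservingLocus hT hμ (htr A hA) (hne A hA) hv hTv hl'⟩,
      r, hr, r.2, mk_not_mem_preservingLocus hT hμ (htr A hA) (hne A hA) hv hTv hr'⟩
  refine hF.union_of_chain C i ?_ fun m hm hF₁ => ?_
  · rintro z ⟨hzD, hz⟩
    by_contra hzF
    obtain ⟨A, rfl⟩ := exists_mk z
    obtain ⟨⟨l, hl, hl'⟩, -⟩ := hnon A ⟨hzD, hzF⟩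
    exact hl' (hz l hl)
  refine hF₁.union_of_chain (fun l => C (i + l)) (n + 3 - i) ?_ fun r hr hF₂ => ?_
  · rintro z ⟨⟨hzD, -⟩, hz⟩
    left
    by_contra hzF
    obtain ⟨A, rfl⟩ := exists_mk z
    obtain ⟨-, l, hl, hl', hlC⟩ := hnon A ⟨hzD, hzF⟩
    have := hz (l - i) (by omega)
    rw [Nat.add_sub_cancel' hl] at this
    exact hlC this
  have hD₂ : IsClosed (D ∩ {x | ∀ l < m, x ∈ C l} ∩ {x | ∀ l < r, x ∈ C (i + l)}) :=
    (hD.inter (isClosed_setOf_forall_lt hCcl m)).inter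
      (isClosed_setOf_forall_lt (fun l => hCcl (i + l)) r)
  refine hF₂.union hD₂ ?_
  obtain ⟨Z, hZ⟩ : ∃ Z, Z = (D ∩ {x | ∀ l < m, x ∈ C l} ∩ {x | ∀ l < r, x ∈ C (i + l)}) \
    (F ∪ D ∩ {x | ∀ l < m + 1, x ∈ C l} ∪
      D ∩ {x | ∀ l < m, x ∈ C l} ∩ {x | ∀ l < r + 1, x ∈ C (i + l)}) := ⟨_, rfl⟩
  rw [← hZ]
  have hZlc : IsLocallyClosed Z := by
    rw [hZ, Set.sdiff_eq]
    exact hD₂.isLocallyClosed.inter hF₂.isClosed.isOpen_compl.isLocallyClosed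
  have hZmem : ∀ z, z ∈ Z ↔ z ∈ D \ F ∧ (∀ l < m, z ∈ C l) ∧ z ∉ C m ∧
      (∀ l < r, z ∈ C (i + l)) ∧ z ∉ C (i + r) := fun z => by
    rw [hZ]
    exact mem_diff_chain_iff
  refine hP Z (fun z hz => ((hZmem z).mp hz).1) ?_
  refine isProductWithAffineLine_of_eigenline_left hgen hc hZlc hi.le hT hμ hTleft
    (fun A hA => htr A ((hZmem _).mp hA).1) (fun A hA => hne A ((hZmem _).mp hA).1) he
    (fun A hA => hB A ((hZmem _).mp hA).1) (m := ⟨m, by omega⟩) (r := ⟨i + r, by omega⟩) hm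
    (Nat.le_add_right i r) (fun A hA => hC ▸ ((hZmem _).mp hA).2.2.1)
    (fun A hA => hC ▸ ((hZmem _).mp hA).2.2.2.2) fun A B hA hAB hCB => ?_
  have hA' := (hZmem _).mp hA
  rw [← hC] at hCB
  refine (hZmem _).mpr ⟨hDF A B hAB hA'.1, ?_⟩
  simpa only [hCB] using hA'.2

end Bad

/-! ### Unstable pairs of pants -/

section Unstable

open Matrix ModuliSpace
open FramedLocalSystem hiding mk

variable {n : ℕ} {c : Fin (n + 3) → ℂ}

/-- When two triangular matrices are conjugated by different unipotent matrices, so that their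
product changes, the product is conjugate to the original one by a third unipotent matrix as soon
as the entries above the diagonal match. -/
theorem upperUnipotent_conj_mul_conj {B A : SL2} {a μ : ℂ}
    (hB0 : B.val 0 0 = a) (hB1 : B.val 1 0 = 0) (hA0 : A.val 0 0 = μ) (hA1 : A.val 1 0 = 0)
    {α β : ℂ} (h : a * (μ⁻¹ - μ) + μ⁻¹ * α * (a⁻¹ - a) = β * ((a * μ)⁻¹ - a * μ)) (x : ℂ) :
    upperUnipotent (x * α) * B * (upperUnipotent (x * α))⁻¹ *
      (upperUnipotent x * A * (upperUnipotent x)⁻¹) =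
      upperUnipotent (x * β) * (B * A) * (upperUnipotent (x * β))⁻¹ := by
  have hB := B.2
  have hA := A.2
  rw [Matrix.det_fin_two, hB0, hB1, mul_zero, sub_zero] at hB
  rw [Matrix.det_fin_two, hA0, hA1, mul_zero, sub_zero] at hA
  have hB2 : B.val 1 1 = a⁻¹ := eq_inv_of_mul_eq_one_right hB
  have hA2 : A.val 1 1 = μ⁻¹ := eq_inv_of_mul_eq_one_right hA
  apply Subtype.ext
  rw [upperUnipotent_conj, Matrix.SpecialLinearGroup.coe_mul, upperUnipotent_conj,
    upperUnipotent_conj, Matrix.SpecialLinearGroup.coe_mul]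
  have e00 : (B.val * A.val) 0 0 = a * μ := by
    rw [Matrix.mul_apply, Fin.sum_univ_two, hB0, hA0, hA1, mul_zero, add_zero]
  have e01 : (B.val * A.val) 0 1 = a * A.val 0 1 + B.val 0 1 * μ⁻¹ := by
    rw [Matrix.mul_apply, Fin.sum_univ_two, hB0, hA2]
  have e10 : (B.val * A.val) 1 0 = 0 := by
    rw [Matrix.mul_apply, Fin.sum_univ_two, hB1, hA1, mul_zero, zero_mul, add_zero]
  have e11 : (B.val * A.val) 1 1 = (a * μ)⁻¹ := by
    rw [Matrix.mul_apply, Fin.sum_univ_two, hB1, hA2, hB2, mul_inv, zero_mul, zero_add]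
  rw [e00, e01, e10, e11, hA0, hA1, hA2, hB0, hB1, hB2]
  ext i j
  fin_cases i <;> fin_cases j <;> simp [Matrix.mul_apply, Fin.sum_univ_two]
  · linear_combination x * h
  · ring

theorem trace_conj_SL2 (g A : SL2) : (g * A * g⁻¹ : SL2).val.trace = A.val.trace := by
  have h : g⁻¹ * (g * A) = A := by group
  rw [Matrix.SpecialLinearGroup.coe_mul, Matrix.trace_mul_comm,
    ← Matrix.SpecialLinearGroup.coe_mul, h]

theorem inv_ne_self_of_trace {a : ℂ} (ha : a ≠ 0) (h : a + a⁻¹ ≠ 2 ∧ a + a⁻¹ ≠ -2) : a⁻¹ ≠ a :=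
  inv_ne_self_of_ne ha (fun h1 => h.1 (by rw [h1]; norm_num))
    (fun h1 => h.2 (by rw [h1]; norm_num))

/-- On a locus where the local system is unstable on the pair of pants with monodromies
`B = A₁ ⋯ A_{i-1}` and `A_i`, while `B` and `B A_i` have distinct eigenvalues, let `Z` be a piece on
which `A_m` does not preserve the destabilizing line. Deforming the extension class of the
restriction to the pair of pants is a flow, which conjugates `A_i` and the matrices on one of its
sides by the unipotent matrices fixing the line; the side containing `A_m` is not moved. -/
theorem isProductWithAffineLine_of_unstable (hgen : VeryGeneric c)
    (hc : ∀ i, c i ≠ 0 ∧ c i ≠ 1 ∧ c i ≠ -1) {Z : Set (ModuliSpace c)} (hZlc : IsLocallyClosed Z)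
    {a m : Fin (n + 3)}
    (hBad : ∀ A, mk A ∈ Z → lineDefect (A.mat a).val (c a)⁻¹ (A.partialProd a).val = 0)
    (htr : ∀ A, mk A ∈ Z → (A.partialProd a).val.trace ≠ 2 ∧ (A.partialProd a).val.trace ≠ -2)
    (htr' : ∀ A, mk A ∈ Z →
      (A.partialProd (a + 1)).val.trace ≠ 2 ∧ (A.partialProd (a + 1)).val.trace ≠ -2)
    (hZm : ∀ A, mk A ∈ Z → mk A ∉ preservingLocus (fun A => A.mat a) (c a)⁻¹ m)
    (hZ : ∀ (A B : FramedLocalSystem c) (g : SL2), mk A ∈ Z →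
      (∀ l : Fin (n + 3), l < a → B.mat l = g * A.mat l * g⁻¹) →
      (∀ j, j ≤ n + 3 → (B.partialProd j).val.trace = (A.partialProd j).val.trace) →
      lineDefect (B.mat a).val (c a)⁻¹ (B.partialProd a).val = 0 →
      (∀ l, mk B ∈ preservingLocus (fun A => A.mat a) (c a)⁻¹ l ↔
        mk A ∈ preservingLocus (fun A => A.mat a) (c a)⁻¹ l) → mk B ∈ Z) :
    IsProductWithAffineLine Z := by
  obtain ⟨μ, hμc⟩ : ∃ μ, μ = (c a)⁻¹ := ⟨_, rfl⟩
  have hμ : μ ≠ 0 := hμc ▸ inv_ne_zero (hc a).1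
  have hμ' : μ⁻¹ ≠ μ := by
    rw [hμc, inv_inv]
    exact (inv_ne_self_of_ne (hc a).1 (hc a).2.1 (hc a).2.2).symm
  rw [← hμc] at hBad hZm hZ
  have hT : IsEquivariantRegular fun A : FramedLocalSystem c => (A.mat a).val :=
    IsEquivariantRegular.mat a
  have hTtr : ∀ A : FramedLocalSystem c, (A.mat a).val.trace = μ + μ⁻¹ := fun A => by
    rw [A.trace_mat, hμc, inv_inv, add_comm]
  have hTne : ∀ A : FramedLocalSystem c, (A.mat a).val ≠ μ • 1 ∧ (A.mat a).val ≠ μ⁻¹ • 1 :=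
    fun A => ne_smul_one_of_trace hμ' (hTtr A)
  have hmdef : ∀ A, mk A ∈ Z → lineDefect (A.mat a).val μ (A.mat m).val ≠ 0 := by
    intro A hA h0
    have h1 := hZm A hA
    rw [mk_mem_preservingLocus hT] at h1
    exact h1 fun _ => h0
  -- on the slice, the monodromies of the pair of pants are upper triangular
  have hshape : ∀ A ∈ normalizedSlice Z (fun A => A.mat a) μ m,
      (A.partialProd a).val 1 0 = 0 ∧ (A.partialProd a).val 0 0 ≠ 0 ∧
      ((A.partialProd a).val 0 0)⁻¹ ≠ (A.partialProd a).val 0 0 ∧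
      ((A.partialProd a).val 0 0 * μ)⁻¹ ≠ (A.partialProd a).val 0 0 * μ := by
    intro A hA
    have hp : (A.partialProd a).val 1 0 = 0 :=
      (lineDefect_eq_zero_iff_of_upper hμ (hTne A).1 (hTne A).2 hA.2.1 hA.2.2.1).mp
        (hBad A hA.1)
    have hdet := (A.partialProd a).2
    rw [Matrix.det_fin_two, hp, mul_zero, sub_zero] at hdet
    have h0 : (A.partialProd a).val 0 0 ≠ 0 := left_ne_zero_of_mul_eq_one hdet
    have h11 : (A.partialProd a).val 1 1 = ((A.partialProd a).val 0 0)⁻¹ :=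
      eq_inv_of_mul_eq_one_right hdet
    have hdet' := (A.mat a).2
    have hA0 : (A.mat a).val 0 0 = μ := hA.2.1
    have hA1 : (A.mat a).val 1 0 = 0 := hA.2.2.1
    rw [Matrix.det_fin_two, hA0, hA1, mul_zero, sub_zero] at hdet'
    have h11' : (A.mat a).val 1 1 = μ⁻¹ := eq_inv_of_mul_eq_one_right hdet'
    have h1 := htr A hA.1
    have h2 := htr' A hA.1
    rw [Matrix.trace_fin_two, h11] at h1
    rw [A.partialProd_succ a, Matrix.SpecialLinearGroup.coe_mul, Matrix.trace_fin_two,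
      Matrix.mul_apply, Matrix.mul_apply, Fin.sum_univ_two, Fin.sum_univ_two, hp, hA0, hA1, h11,
      h11', mul_zero, add_zero, zero_mul, zero_add, ← mul_inv] at h2
    exact ⟨hp, h0, inv_ne_self_of_trace h0 h1, inv_ne_self_of_trace (mul_ne_zero h0 hμ) h2⟩
  -- the speed of the flow on the two sides of the pair of pants
  obtain ⟨α, hα⟩ : ∃ α : ℂ → ℂ, α = fun b => if m < a then 0 else
    -(b * (μ⁻¹ - μ)) / (μ⁻¹ * (b⁻¹ - b)) := ⟨_, rfl⟩
  obtain ⟨β, hβ⟩ : ∃ β : ℂ → ℂ, β = fun b => if m < a then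
    b * (μ⁻¹ - μ) / ((b * μ)⁻¹ - b * μ) else 0 := ⟨_, rfl⟩
  have hαβ : ∀ b : ℂ, b⁻¹ ≠ b → (b * μ)⁻¹ ≠ b * μ →
      b * (μ⁻¹ - μ) + μ⁻¹ * α b * (b⁻¹ - b) = β b * ((b * μ)⁻¹ - b * μ) := by
    intro b h1 h2
    have h1' := sub_ne_zero.mpr h1
    have h2' := sub_ne_zero.mpr h2
    rw [hα, hβ]
    by_cases hma : m < a
    · simp only [hma, if_true]
      rw [div_mul_cancel₀ _ h2', mul_zero, zero_mul, add_zero]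
    · simp only [hma, if_false]
      rw [mul_right_comm, mul_div_cancel₀ _ (mul_ne_zero (inv_ne_zero hμ) h1')]
      ring
  obtain ⟨γ, hγ⟩ : ∃ γ : Fin (n + 3) → FramedLocalSystem c → ℂ, γ = fun l A =>
    if l < a then α ((A.partialProd a).val 0 0) else if l = a then 1 else
      β ((A.partialProd a).val 0 0) := ⟨_, rfl⟩
  have hγl : ∀ l A, l < a → γ l A = α ((A.partialProd a).val 0 0) := fun l A hl => by
    rw [hγ]
    simp only [hl, if_true]
  have hγa : ∀ A, γ a A = 1 := fun A => by
    rw [hγ]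
    simp
  have hγr : ∀ l A, a < l → γ l A = β ((A.partialProd a).val 0 0) := fun l A hl => by
    rw [hγ]
    simp only [not_lt.mpr hl.le, hl.ne', if_false]
  have hpreg : ∀ A : FramedLocalSystem c, RegularAt (fun A => (A.partialProd a).val 0 0) A :=
    (IsEquivariantRegular.partialProd a.2.le).regular 0 0
  have hγreg : ∀ l, ∀ A ∈ normalizedSlice Z (fun A => A.mat a) μ m, RegularAt (γ l) A := by
    intro l A hA
    obtain ⟨-, h0, h1, h2⟩ := hshape A hA
    rcases lt_trichotomy l a with hl | rfl | hl
    · rw [funext fun A => hγl l A hl, hα]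
      by_cases hma : m < a
      · simp only [hma, if_true]
        exact RegularFunctions.RegularAt.const _ A
      · simp only [hma, if_false]
        exact ((hpreg A).mul (.const _ A)).neg.div
          ((RegularFunctions.RegularAt.const _ A).mul (((hpreg A).inv h0).sub (hpreg A)))
          (mul_ne_zero (inv_ne_zero hμ) (sub_ne_zero.mpr h1))
    · rw [funext hγa]
      exact RegularFunctions.RegularAt.const _ A
    · rw [funext fun A => hγr l A hl, hβ]
      by_cases hma : m < a
      · simp only [hma, if_true]
        have hb := (hpreg A).mul (RegularFunctions.RegularAt.const μ A)
        exact ((hpreg A).mul (.const _ A)).div ((hb.inv (mul_ne_zero h0 hμ)).sub hb)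
          (sub_ne_zero.mpr h2)
      · simp only [hma, if_false]
        exact RegularFunctions.RegularAt.const _ A
  refine isProductWithAffineLine_of_flow hgen hc hZlc hT hμ (m := m) (fun A _ => hTtr A) hmdef γ
    (fun A => (A.mat a).val 0 1 / (μ⁻¹ - μ)) hγreg
    (fun A _ => (regularAt_mat a 0 1 A).div (.const _ A) (sub_ne_zero.mpr hμ')) ?_
  intro A hA x
  obtain ⟨hp1, hp0, h1, h2⟩ := hshape A hA
  have hA0 : (A.mat a).val 0 0 = μ := hA.2.1
  have hA1 : (A.mat a).val 1 0 = 0 := hA.2.2.1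
  obtain ⟨b, hb⟩ : ∃ b, b = (A.partialProd a).val 0 0 := ⟨_, rfl⟩
  obtain ⟨g, hg⟩ : ∃ g : Fin (n + 3) → SL2, g = fun l => upperUnipotent (x * γ l A) := ⟨_, rfl⟩
  have hgl : ∀ l, l < a → g l = upperUnipotent (x * α b) := fun l hl => by
    simp only [hg, hγl l A hl, hb]
  have hga : g a = upperUnipotent x := by
    simp only [hg, hγa, mul_one]
  have hgr : ∀ l, a < l → g l = upperUnipotent (x * β b) := fun l hl => by
    simp only [hg, hγr l A hl, hb]
  have hleft : ∀ j ≤ (a : ℕ), ((List.ofFn fun l => g l * A.mat l * (g l)⁻¹).take j).prod =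
      upperUnipotent (x * α b) * A.partialProd j * (upperUnipotent (x * α b))⁻¹ := fun j hj =>
    prod_take_ofFn_conj (M := A.mat) _ (Nat.zero_le j) (by omega)
      (by rw [List.take_zero, List.take_zero, List.prod_nil, mul_one, mul_inv_cancel])
      fun l _ hl => by rw [hgl l (Fin.lt_def.mpr (lt_of_lt_of_le hl hj))]
  have hmid : ((List.ofFn fun l => g l * A.mat l * (g l)⁻¹).take (a + 1)).prod =
      upperUnipotent (x * β b) * A.partialProd (a + 1) * (upperUnipotent (x * β b))⁻¹ := by
    rw [prod_take_ofFn_succ, hleft a le_rfl, hga, A.partialProd_succ a]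
    exact upperUnipotent_conj_mul_conj hb.symm hp1 hA0 hA1
      (hαβ b (hb ▸ h1) (hb ▸ h2)) x
  have hright : ∀ j, (a : ℕ) + 1 ≤ j → j ≤ n + 3 →
      ((List.ofFn fun l => g l * A.mat l * (g l)⁻¹).take j).prod =
      upperUnipotent (x * β b) * A.partialProd j * (upperUnipotent (x * β b))⁻¹ := fun j hj hj' =>
    prod_take_ofFn_conj (M := A.mat) _ hj hj' hmid fun l hl _ => by rw [hgr l hl]
  have hall := hright (n + 3) (by omega) le_rfl
  rw [List.take_of_length_le (by simp), partialProd_all, mul_one, mul_inv_cancel] at hall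
  have hBmat : ∀ l, (A.twist g hall).mat l = g l * A.mat l * (g l)⁻¹ := fun l => rfl
  have hBp : ∀ j, (A.twist g hall).partialProd j =
    ((List.ofFn fun l => g l * A.mat l * (g l)⁻¹).take j).prod := fun j => rfl
  generalize A.twist g hall = B at hBmat hBp
  have hBa : (B.mat a).val = !![μ, (A.mat a).val 0 1 + x * (μ⁻¹ - μ); 0, (A.mat a).val 1 1] := by
    have hdet' := (A.mat a).2
    rw [Matrix.det_fin_two, hA0, hA1, mul_zero, sub_zero] at hdet'
    have h11' : (A.mat a).val 1 1 = μ⁻¹ := eq_inv_of_mul_eq_one_right hdet'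
    rw [hBmat, hga, upperUnipotent_conj, hA0, hA1, h11']
    ext i j
    fin_cases i <;> fin_cases j <;> simp
    ring
  have hB0 : (B.mat a).val 0 0 = μ := by rw [hBa]; rfl
  have hB1 : (B.mat a).val 1 0 = 0 := by rw [hBa]; rfl
  have hBpa : (B.partialProd a).val 0 0 = b ∧ (B.partialProd a).val 1 0 = 0 := by
    rw [hBp, hleft a le_rfl, upperUnipotent_conj, hp1, ← hb]
    simp
  have hBtr : ∀ j, j ≤ n + 3 → (B.partialProd j).val.trace = (A.partialProd j).val.trace := by
    intro j hj
    by_cases hja : j ≤ (a : ℕ)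
    · rw [hBp, hleft j hja, trace_conj_SL2]
    · rw [hBp, hright j (by omega) hj, trace_conj_SL2]
  have hBdef : lineDefect (B.mat a).val μ (B.partialProd a).val = 0 :=
    (lineDefect_eq_zero_iff_of_upper hμ (hTne B).1 (hTne B).2 hB0 hB1).mpr hBpa.2
  have hBZ : mk B ∈ Z := hZ A B (upperUnipotent (x * α b)) hA.1
    (fun l hl => by rw [hBmat, hgl l hl]) hBtr hBdef fun l =>
      mk_mem_preservingLocus_congr hT hμ (t := fun l => x * γ l A)
        (fun l => by rw [hBmat, hg]) (hTne A) (hTne B) hA0 hA1 hB0 hB1 l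
  have hma : m ≠ a := by
    intro h
    have h3 := hA.2.2.2.2
    rw [h, hA1] at h3
    exact zero_ne_one h3
  have hBm : B.mat m = A.mat m := by
    have hgm : g m = 1 := by
      rcases lt_or_gt_of_ne hma with h | h
      · rw [hgl m h, hα]
        simp only [h, if_true, mul_zero, upperUnipotent_zero]
      · rw [hgr m h, hβ]
        simp only [not_lt.mpr h.le, if_false, mul_zero, upperUnipotent_zero]
    rw [hBmat, hgm, one_mul, inv_one, mul_one]
  refine ⟨B, ⟨hBZ, hB0, hB1, hBm ▸ hA.2.2.2.1, hBm ▸ hA.2.2.2.2⟩, fun l => by rw [hBmat, hg],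
    fun l => ?_, ?_⟩
  · rw [hγ]
    simp only [hBpa.1, hb]
  · have h3 := sub_ne_zero.mpr hμ'
    have h4 : (B.mat a).val 0 1 = (A.mat a).val 0 1 + x * (μ⁻¹ - μ) := by rw [hBa]; rfl
    rw [h4, add_div, mul_div_cancel_right₀ _ h3]

/-- The locus that is unstable on a pair of pants, with distinct eigenvalues around the boundary,
can be filtered by pieces with an affine line factor, according to the first matrix that does not
preserve the destabilizing line. -/
theorem ClosedFiltration.union_of_unstable (hgen : VeryGeneric c)
    (hc : ∀ i, c i ≠ 0 ∧ c i ≠ 1 ∧ c i ≠ -1) {P : Set (ModuliSpace c) → Prop}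
    {F D : Set (ModuliSpace c)} (hF : ClosedFiltration P F) (hD : IsClosed D)
    (hP : ∀ Z ⊆ D \ F, IsProductWithAffineLine Z → P Z) {a : Fin (n + 3)}
    (hBad : ∀ A, mk A ∈ D \ F → lineDefect (A.mat a).val (c a)⁻¹ (A.partialProd a).val = 0)
    (htr : ∀ A, mk A ∈ D \ F → (A.partialProd a).val.trace ≠ 2 ∧ (A.partialProd a).val.trace ≠ -2)
    (htr' : ∀ A, mk A ∈ D \ F →
      (A.partialProd (a + 1)).val.trace ≠ 2 ∧ (A.partialProd (a + 1)).val.trace ≠ -2)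
    (hDF : ∀ (A B : FramedLocalSystem c) (g : SL2), mk A ∈ D \ F →
      (∀ l : Fin (n + 3), l < a → B.mat l = g * A.mat l * g⁻¹) →
      (∀ j, j ≤ n + 3 → (B.partialProd j).val.trace = (A.partialProd j).val.trace) →
      lineDefect (B.mat a).val (c a)⁻¹ (B.partialProd a).val = 0 → mk B ∈ D \ F) :
    ClosedFiltration P (F ∪ D) := by
  have hc0 : ∀ i, c i ≠ 0 := fun i => (hc i).1
  have hT : IsEquivariantRegular fun A : FramedLocalSystem c => (A.mat a).val :=
    IsEquivariantRegular.mat a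
  obtain ⟨C, hC⟩ : ∃ C : ℕ → Set (ModuliSpace c),
    C = preservingLocus (fun A => A.mat a) (c a)⁻¹ := ⟨_, rfl⟩
  have hCcl : ∀ l, IsClosed (C l) := fun l => hC ▸ isClosed_preservingLocus hT l
  refine hF.union_of_chain C (n + 3) ?_ fun m hm hF₁ => ?_
  · rintro z ⟨-, hz⟩
    exfalso
    obtain ⟨A, rfl⟩ := exists_mk z
    have h0 := inv_ne_zero (hc0 a)
    have htrA : (A.mat a).val.trace = (c a)⁻¹ + (c a)⁻¹⁻¹ := by
      rw [A.trace_mat, inv_inv, add_comm]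
    have hne := ne_smul_one_of_trace
      (by rw [inv_inv]; exact (inv_ne_self_of_ne (hc a).1 (hc a).2.1 (hc a).2.2).symm) htrA
    obtain ⟨v, hv, hTv, -⟩ := exists_eigenvector h0 htrA hne.2
    obtain ⟨l, hl⟩ := hgen.exists_not_eigenvector hc0 A hv
    exact mk_not_mem_preservingLocus hT h0 htrA hne hv hTv hl (hC ▸ hz l l.2)
  have hD₁ : IsClosed (D ∩ {x | ∀ l < m, x ∈ C l}) := hD.inter (isClosed_setOf_forall_lt hCcl m)
  refine hF₁.union hD₁ ?_
  obtain ⟨Z, hZ⟩ : ∃ Z, Z = (D ∩ {x | ∀ l < m, x ∈ C l}) \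
    (F ∪ D ∩ {x | ∀ l < m + 1, x ∈ C l}) := ⟨_, rfl⟩
  rw [← hZ]
  have hZlc : IsLocallyClosed Z := by
    rw [hZ, Set.sdiff_eq]
    exact hD₁.isLocallyClosed.inter hF₁.isClosed.isOpen_compl.isLocallyClosed
  have hZmem : ∀ z, z ∈ Z ↔ z ∈ D \ F ∧ (∀ l < m, z ∈ C l) ∧ z ∉ C m := fun z => by
    have h1 : (∀ l < m + 1, z ∈ C l) ↔ (∀ l < m, z ∈ C l) ∧ z ∈ C m := Nat.forall_lt_succ_right
    have taut : ∀ d f p q : Prop, (d ∧ p) ∧ ¬(f ∨ d ∧ p ∧ q) ↔ (d ∧ ¬f) ∧ p ∧ ¬q := by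
      intros
      tauto
    rw [hZ]
    show (z ∈ D ∧ ∀ l < m, z ∈ C l) ∧ ¬(z ∈ F ∨ z ∈ D ∧ ∀ l < m + 1, z ∈ C l) ↔ _
    rw [h1]
    exact taut _ _ _ _
  refine hP Z (fun z hz => ((hZmem z).mp hz).1) ?_
  refine isProductWithAffineLine_of_unstable hgen hc hZlc (a := a) (m := ⟨m, hm⟩)
    (fun A hA => hBad A ((hZmem _).mp hA).1) (fun A hA => htr A ((hZmem _).mp hA).1)
    (fun A hA => htr' A ((hZmem _).mp hA).1) (fun A hA => hC ▸ ((hZmem _).mp hA).2.2)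
    fun A B g hA h1 h2 h3 hCB => ?_
  have hA' := (hZmem _).mp hA
  rw [← hC] at hCB
  refine (hZmem _).mpr ⟨hDF A B g hA'.1 h1 h2 h3, ?_⟩
  simpa only [hCB] using hA'.2

end Unstable

/-! ### The strata as differences of closed sets -/

theorem isOrderedStratification_of_closed {X : Type*} [TopologicalSpace X] {D : ℕ → Set X}
    (hD : ∀ j, IsClosed (D j)) {U : Set X} {N : ℕ} (hU : U = {x | ∀ i < N, x ∉ D i})
    {Z : Fin N → Set X} (hZ : ∀ j x, x ∈ Z j ↔ x ∈ D j ∧ ∀ i < (j : ℕ), x ∉ D i) :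
    IsOrderedStratification U Z := by
  have hF : ∀ m, IsClosed {x | ∃ i < m, x ∈ D i} := fun m => by
    have h : {x | ∃ i < m, x ∈ D i} = ⋃ i ∈ Finset.range m, D i := by
      ext x
      simp
    rw [h]
    exact isClosed_biUnion_finset fun i _ => hD i
  have hfirst : ∀ m x, (∃ i < m, x ∈ D i) → ∃ i < m, x ∈ D i ∧ ∀ l < i, x ∉ D l := by
    classical
    intro m x h
    have h' : ∃ i, x ∈ D i := h.imp fun i hi => hi.2
    obtain ⟨i, hi, hx⟩ := h
    exact ⟨Nat.find h', lt_of_le_of_lt (Nat.find_min' h' hx) hi, Nat.find_spec h',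
      fun l hl => Nat.find_min h' hl⟩
  refine ⟨?_, fun j => ?_, fun j => ?_, fun i j hij => ?_, ?_, fun a => ?_⟩
  · have h : U = {x | ∃ i < N, x ∈ D i}ᶜ := by
      rw [hU]
      ext x
      show (∀ i < N, x ∉ D i) ↔ ¬∃ i < N, x ∈ D i
      push Not
      rfl
    rw [h]
    exact (hF N).isOpen_compl
  · have h : Z j = D j ∩ {x | ∃ i < (j : ℕ), x ∈ D i}ᶜ := by
      ext x
      rw [hZ]
      show _ ↔ x ∈ D j ∧ ¬∃ i < (j : ℕ), x ∈ D i
      push Not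
      rfl
    rw [h]
    exact (hD j).isLocallyClosed.inter (hF j).isOpen_compl.isLocallyClosed
  · rw [hU, Set.disjoint_left]
    intro x hx hx'
    exact hx j j.2 ((hZ j x).mp hx').1
  · refine Set.disjoint_left.mpr fun x hx hx' => ?_
    rcases lt_or_gt_of_ne hij with h | h
    · exact ((hZ j x).mp hx').2 i h ((hZ i x).mp hx).1
    · exact ((hZ i x).mp hx).2 j h ((hZ j x).mp hx').1
  · ext x
    simp only [Set.mem_univ, iff_true]
    by_cases h : ∃ i < N, x ∈ D i
    · obtain ⟨i, hi, h1, h2⟩ := hfirst N x h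
      exact Or.inr (Set.mem_iUnion.mpr ⟨⟨i, hi⟩, (hZ _ x).mpr ⟨h1, h2⟩⟩)
    · left
      rw [hU]
      exact fun i hi hx => h ⟨i, hi, hx⟩
  · convert hF (a + 1) using 1
    ext x
    simp only [Set.mem_iUnion]
    constructor
    · rintro ⟨j, hja, hj⟩
      exact ⟨j, Nat.lt_succ_of_le hja, ((hZ j x).mp hj).1⟩
    · intro h
      obtain ⟨i, hi, h1, h2⟩ := hfirst _ x h
      exact ⟨⟨i, by omega⟩, Nat.le_of_lt_succ hi, (hZ _ x).mpr ⟨h1, h2⟩⟩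

section Strata

open Matrix ModuliSpace
open FramedLocalSystem hiding mk

variable {n : ℕ} {c : Fin (n + 3) → ℂ}

theorem FramedLocalSystem.isUnstable_iff (hc : ∀ i, c i ≠ 0 ∧ c i ≠ 1 ∧ c i ≠ -1)
    (A : FramedLocalSystem c) (p : Fin (n + 1)) : A.IsUnstable p ↔
      lineDefect (A.mat p.succ.castSucc).val (c p.succ.castSucc)⁻¹
        (A.partialProd (p + 1)).val = 0 := by
  obtain ⟨a, ha⟩ : ∃ a, a = p.succ.castSucc := ⟨_, rfl⟩
  have h0 := inv_ne_zero (hc a).1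
  have htrA : (A.mat a).val.trace = (c a)⁻¹ + (c a)⁻¹⁻¹ := by
    rw [A.trace_mat, inv_inv, add_comm]
  have hne := ne_smul_one_of_trace
    (by rw [inv_inv]; exact (inv_ne_self_of_ne (hc a).1 (hc a).2.1 (hc a).2.2).symm) htrA
  unfold IsUnstable
  rw [← ha]
  constructor
  · rintro ⟨v, hv, hb, hv'⟩
    exact (lineDefect_eq_zero_iff h0 htrA hne.1 hne.2 hv hv').mpr hb
  · intro h
    obtain ⟨v, hv, hTv, -⟩ := exists_eigenvector h0 htrA hne.2
    exact ⟨v, hv, (lineDefect_eq_zero_iff h0 htrA hne.1 hne.2 hv hTv).mp h, hTv⟩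

/-- The conditions that fail on the open stratum, in the order in which they are removed: first
a monodromy around some `ρ_q` with trace `±2`, then an unstable pair of pants. -/
def FramedLocalSystem.IsBad (A : FramedLocalSystem c) (j : ℕ) : Prop :=
  (∃ q : Fin n, (q : ℕ) = j ∧ A.partialProd (q + 2) ∉ traceNeTwo) ∨
    ∃ p : Fin (n + 1), n + (p : ℕ) = j ∧ A.IsUnstable p

theorem FramedLocalSystem.isBad_castAdd (A : FramedLocalSystem c) (q : Fin n) :
    A.IsBad q ↔ A.partialProd (q + 2) ∉ traceNeTwo := by
  constructor
  · rintro (⟨q', h, h'⟩ | ⟨p, h, -⟩)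
    · rwa [h] at h'
    · omega
  · exact fun h => Or.inl ⟨q, rfl, h⟩

theorem FramedLocalSystem.isBad_natAdd (A : FramedLocalSystem c) (p : Fin (n + 1)) :
    A.IsBad (n + p) ↔ A.IsUnstable p := by
  constructor
  · rintro (⟨q, h, -⟩ | ⟨p', h, h'⟩)
    · omega
    · obtain rfl : p' = p := Fin.ext (by omega)
      exact h'
  · exact fun h => Or.inr ⟨p, rfl, h⟩

theorem mem_traceNeTwo_iff (A : SL2) : A ∈ traceNeTwo ↔ A.val.trace ≠ 2 ∧ A.val.trace ≠ -2 :=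
  Iff.rfl

theorem not_mem_traceNeTwo_iff (A : SL2) : A ∉ traceNeTwo ↔ A.val.trace = 2 ∨ A.val.trace = -2 := by
  rw [mem_traceNeTwo_iff]
  tauto

theorem isEquivariantRegular_unstable (p : Fin (n + 1)) :
    IsEquivariantRegular fun A : FramedLocalSystem c =>
      lineDefect (A.mat p.succ.castSucc).val (c p.succ.castSucc)⁻¹ (A.partialProd (p + 1)).val :=
  (IsEquivariantRegular.mat _).lineDefect (IsEquivariantRegular.partialProd (by omega)) _

theorem isInvariant_isBad (hc : ∀ i, c i ≠ 0 ∧ c i ≠ 1 ∧ c i ≠ -1) (j : ℕ) :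
    IsInvariant fun A : FramedLocalSystem c => A.IsBad j := by
  rintro A B h (⟨q, hq, h'⟩ | ⟨p, hp, h'⟩)
  · refine Or.inl ⟨q, hq, ?_⟩
    rw [not_mem_traceNeTwo_iff] at h' ⊢
    rwa [← (IsEquivariantRegular.partialProd (by omega)).trace_eq h]
  · refine Or.inr ⟨p, hp, ?_⟩
    rw [isUnstable_iff hc] at h' ⊢
    exact ((isEquivariantRegular_unstable p).eq_zero_iff h).mp h'

theorem isClosed_locus_isBad (hc : ∀ i, c i ≠ 0 ∧ c i ≠ 1 ∧ c i ≠ -1) (j : ℕ) :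
    IsClosed (locus fun A : FramedLocalSystem c => A.IsBad j) := by
  refine isClosed_locus (isInvariant_isBad hc j) ?_
  have h : {A : FramedLocalSystem c | A.IsBad j} =
      (⋃ q : Fin n, ⋃ _ : (q : ℕ) = j,
        {A | (A.partialProd (q + 2)).val.trace = 2} ∪
          {A | (A.partialProd (q + 2)).val.trace = -2}) ∪
      ⋃ p : Fin (n + 1), ⋃ _ : n + (p : ℕ) = j,
        {A | lineDefect (A.mat p.succ.castSucc).val (c p.succ.castSucc)⁻¹
          (A.partialProd (p + 1)).val = 0} := by
    ext A
    simp only [Set.mem_union, Set.mem_iUnion, exists_prop]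
    refine or_congr (exists_congr fun q => and_congr Iff.rfl (not_mem_traceNeTwo_iff _))
      (exists_congr fun p => and_congr Iff.rfl (A.isUnstable_iff hc p))
  rw [h]
  refine (isClosed_iUnion_of_finite fun q => isClosed_iUnion_of_finite fun _ => ?_).union
    (isClosed_iUnion_of_finite fun p => isClosed_iUnion_of_finite fun _ =>
      (isEquivariantRegular_unstable p).isClosed_setOf_eq_zero)
  have hq := IsEquivariantRegular.partialProd (c := c) (j := q + 2) (by omega)
  exact (hq.isClosed_setOf_trace_eq 2).union (hq.isClosed_setOf_trace_eq (-2))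

open Classical in
/-- The datum of the local systems for which the condition numbered `j` fails and the previous
ones hold, the later ones being arbitrary. -/
noncomputable def firstBadDatum (n j : ℕ) : StratumDatum n where
  σ p := if n + (p : ℕ) < j then {1} else if n + (p : ℕ) = j then {0} else Set.univ
  σ_nonempty p := by
    split_ifs
    exacts [Set.singleton_nonempty _, Set.singleton_nonempty _, Set.univ_nonempty]
  G q := if (q : ℕ) < j then traceNeTwo else if (q : ℕ) = j then traceNeTwoᶜ else Set.univ
  G_conj := by
    intro q A B hAB hA
    have hconj := (mainDatum (q + 1)).G_conj (Fin.last q)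
    split_ifs at hA ⊢
    · exact hconj A B hAB hA
    · exact fun hB => hA (hconj B A hAB.symm hB)
    · trivial

theorem mem_stratum_firstBadDatum (hc : ∀ i, c i ≠ 0 ∧ c i ≠ 1 ∧ c i ≠ -1) {j : ℕ}
    (hj : j < n + (n + 1)) (z : ModuliSpace c) : z ∈ (firstBadDatum n j).stratum c ↔
      z ∈ locus (fun A : FramedLocalSystem c => A.IsBad j) ∧
        ∀ i < j, z ∉ locus (fun A : FramedLocalSystem c => A.IsBad i) := by
  have h01 : ({0} : Set (Fin 2)) ≠ {1} := by simp
  have hu0 : (Set.univ : Set (Fin 2)) ≠ {0} := fun h => by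
    simpa using h.subset (Set.mem_univ (1 : Fin 2))
  have hu1 : (Set.univ : Set (Fin 2)) ≠ {1} := fun h => by
    simpa using h.subset (Set.mem_univ (0 : Fin 2))
  have key : ∀ A : FramedLocalSystem c,
      ((∀ p, ((firstBadDatum n j).σ p = {0} → A.IsUnstable p) ∧
        ((firstBadDatum n j).σ p = {1} → A.IsStable p)) ∧
        ∀ q : Fin n, A.partialProd (q + 2) ∈ (firstBadDatum n j).G q) ↔
      A.IsBad j ∧ ∀ i < j, ¬A.IsBad i := by
    intro A
    constructor
    · rintro ⟨h1, h2⟩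
      refine ⟨?_, fun i hi => ?_⟩
      · by_cases hjn : j < n
        · have h := h2 ⟨j, hjn⟩
          simp only [firstBadDatum, lt_irrefl, if_false, if_true] at h
          exact Or.inl ⟨⟨j, hjn⟩, rfl, h⟩
        · have h := (h1 ⟨j - n, by omega⟩).1
          have e : n + (j - n) = j := by omega
          simp only [firstBadDatum, e, lt_irrefl, if_false, if_true] at h
          exact Or.inr ⟨⟨j - n, by omega⟩, e, h trivial⟩
      · rintro (⟨q, rfl, hq⟩ | ⟨p, rfl, hp⟩)
        · have h := h2 q
          simp only [firstBadDatum, hi, if_true] at h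
          exact hq h
        · have h := (h1 p).2
          simp only [firstBadDatum, hi, if_true] at h
          exact h trivial hp
    · rintro ⟨h1, h2⟩
      refine ⟨fun p => ?_, fun q => ?_⟩
      · rcases lt_trichotomy (n + (p : ℕ)) j with h | h | h
        · simp only [firstBadDatum, h, if_true]
          refine ⟨fun e => absurd e.symm h01, fun _ hp => h2 _ h ?_⟩
          exact (A.isBad_natAdd p).mpr hp
        · simp only [firstBadDatum, h, lt_irrefl, if_false, if_true]
          refine ⟨fun _ => ?_, fun e => absurd e h01⟩
          rw [← h] at h1
          exact (A.isBad_natAdd p).mp h1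
        · simp only [firstBadDatum, not_lt.mpr h.le, h.ne', if_false]
          exact ⟨fun e => absurd e hu0, fun e => absurd e hu1⟩
      · rcases lt_trichotomy (q : ℕ) j with h | h | h
        · simp only [firstBadDatum, h, if_true]
          by_contra hq
          exact h2 _ h ((A.isBad_castAdd q).mpr hq)
        · simp only [firstBadDatum, h, lt_irrefl, if_false, if_true]
          rw [← h] at h1
          rw [← h]
          exact (A.isBad_castAdd q).mp h1
        · simp only [firstBadDatum, not_lt.mpr h.le, h.ne', if_false]
          trivial
  obtain ⟨A, rfl⟩ := exists_mk z
  have h1 : (firstBadDatum n j).stratum c =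
      locus fun A => A.IsBad j ∧ ∀ i < j, ¬A.IsBad i :=
    congrArg (mk '' ·) (Set.ext key)
  rw [h1, mk_mem_locus, mk_mem_locus (isInvariant_isBad hc j)]
  · simp only [mk_mem_locus (isInvariant_isBad hc _)]
  · rintro A B h ⟨h1, h2⟩
    exact ⟨isInvariant_isBad hc j A B h h1,
      fun i hi hB => h2 i hi (isInvariant_isBad hc i B A h.symm hB)⟩

theorem mainStratum_eq (hc : ∀ i, c i ≠ 0 ∧ c i ≠ 1 ∧ c i ≠ -1) : mainStratum c =
    {z | ∀ i < n + (n + 1), z ∉ locus (fun A : FramedLocalSystem c => A.IsBad i)} := by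
  have h01 : ({1} : Set (Fin 2)) ≠ {0} := by simp
  have key : ∀ A : FramedLocalSystem c,
      ((∀ p, ((mainDatum n).σ p = {0} → A.IsUnstable p) ∧
        ((mainDatum n).σ p = {1} → A.IsStable p)) ∧
        ∀ q : Fin n, A.partialProd (q + 2) ∈ (mainDatum n).G q) ↔
      ∀ i < n + (n + 1), ¬A.IsBad i := by
    intro A
    constructor
    · rintro ⟨h1, h2⟩ i hi (⟨q, rfl, hq⟩ | ⟨p, rfl, hp⟩)
      · exact hq (h2 q)
      · exact (h1 p).2 rfl hp
    · intro h
      refine ⟨fun p => ⟨fun e => absurd e h01, fun _ hp => ?_⟩, fun q => ?_⟩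
      · exact h (n + p) (by omega) ((A.isBad_natAdd p).mpr hp)
      · by_contra hq
        exact h q (by omega) ((A.isBad_castAdd q).mpr hq)
  ext z
  obtain ⟨A, rfl⟩ := exists_mk z
  have h1 : mainStratum c = locus fun A : FramedLocalSystem c => ∀ i < n + (n + 1), ¬A.IsBad i :=
    congrArg (mk '' ·) (Set.ext key)
  rw [h1, mk_mem_locus]
  · show _ ↔ ∀ i < n + (n + 1), mk A ∉ locus (fun A : FramedLocalSystem c => A.IsBad i)
    simp only [mk_mem_locus (isInvariant_isBad hc _)]
  · exact fun A B h h1 i hi hB => h1 i hi (isInvariant_isBad hc i B A h.symm hB)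

/-! ### Refining the strata -/

theorem lineDefect_conj (g : SL2) (μ : ℂ) (T X : SL2) :
    lineDefect (g * T * g⁻¹ : SL2).val μ (g * X * g⁻¹ : SL2).val =
      g.val * lineDefect T.val μ X.val * (g⁻¹ : SL2).val := by
  have h1 : g.val * (g⁻¹ : SL2).val = 1 := congrArg Subtype.val (mul_inv_cancel g)
  have h2 : (g⁻¹ : SL2).val * g.val = 1 := congrArg Subtype.val (inv_mul_cancel g)
  have h3 : ∀ a : ℂ, (g * T * g⁻¹ : SL2).val - a • 1 =
      g.val * (T.val - a • 1) * (g⁻¹ : SL2).val := fun a => by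
    rw [mul_sub, sub_mul, Matrix.mul_smul, Matrix.smul_mul, mul_one, h1]
    rfl
  have h4 : (g * X * g⁻¹ : SL2).val = g.val * X.val * (g⁻¹ : SL2).val := rfl
  have h5 : ∀ Y : Matrix (Fin 2) (Fin 2) ℂ, (g⁻¹ : SL2).val * (g.val * Y) = Y := fun Y => by
    rw [← mul_assoc, h2, one_mul]
  unfold lineDefect
  rw [h3, h3, h4]
  simp only [mul_assoc, h5]

theorem lineDefect_conj_eq_zero_iff (g : SL2) (μ : ℂ) (T X : SL2) :
    lineDefect (g * T * g⁻¹ : SL2).val μ (g * X * g⁻¹ : SL2).val = 0 ↔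
      lineDefect T.val μ X.val = 0 := by
  constructor
  · intro h
    have h1 := lineDefect_conj g⁻¹ μ (g * T * g⁻¹) (g * X * g⁻¹)
    have e : ∀ Y : SL2, g⁻¹ * (g * Y * g⁻¹) * g⁻¹⁻¹ = Y := fun Y => by group
    rwa [h, mul_zero, zero_mul, e, e] at h1
  · intro h
    rw [lineDefect_conj, h, mul_zero, zero_mul]

/-- The locus where the monodromy around `ρ_i` has trace `2e` with `e = ±1` is filtered in two
steps: first the points where this monodromy is `e`, using an eigenline of `A₁`, then the others,
using the unique eigenline of the monodromy. -/
theorem ClosedFiltration.union_locus_trace_eq (hgen : VeryGeneric c)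
    (hc : ∀ i, c i ≠ 0 ∧ c i ≠ 1 ∧ c i ≠ -1) {P : Set (ModuliSpace c) → Prop}
    {F : Set (ModuliSpace c)} (hF : ClosedFiltration P F) {i : ℕ} (hi1 : 1 ≤ i) (hi : i < n + 3)
    (hFleft : ∀ A B : FramedLocalSystem c, (∀ l : Fin (n + 3), l < i → B.mat l = A.mat l) →
      mk B ∈ F → mk A ∈ F) {e : ℂ} (he : e = 1 ∨ e = -1)
    (hP : ∀ Z ⊆ (locus fun A => (A.partialProd i).val.trace = 2 * e) \ F,
      IsProductWithAffineLine Z → P Z) :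
    ClosedFiltration P (F ∪ locus fun A => (A.partialProd i).val.trace = 2 * e) := by
  have hpp := IsEquivariantRegular.partialProd (c := c) hi.le
  have he0 : e ≠ 0 := by rcases he with rfl | rfl <;> norm_num
  have hee : e⁻¹ = e := by rcases he with rfl | rfl <;> norm_num
  have hinv₁ : IsInvariant fun A : FramedLocalSystem c => (A.partialProd i).val = e • 1 :=
    fun A B h hA => (hpp.eq_smul_one_iff h e).mp hA
  have hinv₂ : IsInvariant fun A : FramedLocalSystem c => (A.partialProd i).val.trace = 2 * e :=
    fun A B h hA => (hpp.trace_eq h).symm.trans hA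
  have hsub : (locus fun A : FramedLocalSystem c => (A.partialProd i).val = e • 1) ⊆
      locus fun A => (A.partialProd i).val.trace = 2 * e := by
    rintro _ ⟨A, hA, rfl⟩
    refine ⟨A, ?_, rfl⟩
    have hA' : (A.partialProd i).val = e • 1 := hA
    show (A.partialProd i).val.trace = 2 * e
    rw [hA', trace_smul_one]
  have hleft : ∀ A B : FramedLocalSystem c, (∀ l : Fin (n + 3), l < i → B.mat l = A.mat l) →
      B.partialProd i = A.partialProd i := fun A B h => partialProd_congr hi.le h
  have h0tr : ∀ A : FramedLocalSystem c, (A.mat 0).val.trace = c 0 + (c 0)⁻¹ :=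
    fun A => A.trace_mat 0
  have hF₁ : ClosedFiltration P
      (F ∪ locus fun A : FramedLocalSystem c => (A.partialProd i).val = e • 1) := by
    refine hF.union_of_eigenline_left hgen hc
      (isClosed_locus hinv₁ (hpp.isClosed_setOf_eq_smul_one e))
      (fun Z hZ => hP Z (hZ.trans (Set.sdiff_subset_sdiff_left hsub))) hi1 hi
      (T := fun A => A.mat 0) (IsEquivariantRegular.mat 0) (hc 0).1 (fun A B h hA => ?_)
      (fun A B h => h 0 hi1) (fun A _ => h0tr A)
      (fun A _ => ne_smul_one_of_trace (inv_ne_self_of_ne (hc 0).1 (hc 0).2.1 (hc 0).2.2) (h0tr A))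
      he fun A hA v _ => ?_
    · refine ⟨(mk_mem_locus hinv₁).mpr ?_, fun hB => hA.2 (hFleft A B h hB)⟩
      rw [hleft A B h]
      exact (mk_mem_locus hinv₁).mp hA.1
    · have h1 := (mk_mem_locus hinv₁).mp hA.1
      rw [h1, Matrix.smul_mulVec, Matrix.one_mulVec]
  have hF₂ := hF₁.union_of_eigenline_left hgen hc
      (isClosed_locus hinv₂ (hpp.isClosed_setOf_trace_eq (2 * e)))
      (fun Z hZ => hP Z (hZ.trans (Set.sdiff_subset_sdiff_right Set.subset_union_left))) hi1 hi
      (T := fun A => A.partialProd i) hpp he0 (fun A B h hA => ?_) hleft (fun A hA => ?_)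
      (fun A hA => ?_) he fun A hA v hv => hv
  · rwa [Set.union_assoc, Set.union_eq_self_of_subset_left hsub] at hF₂
  · refine ⟨(mk_mem_locus hinv₂).mpr ?_, fun hB => hA.2 ?_⟩
    · rw [hleft A B h]
      exact (mk_mem_locus hinv₂).mp hA.1
    · rcases hB with hB | hB
      · exact Or.inl (hFleft A B h hB)
      · right
        rw [mk_mem_locus hinv₁] at hB ⊢
        rwa [← hleft A B h]
  · rw [(mk_mem_locus hinv₂).mp hA.1, hee, two_mul]
  · have h1 : (A.partialProd i).val ≠ e • 1 := fun h => hA.2 (Or.inr ((mk_mem_locus hinv₁).mpr h))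
    rw [hee]
    exact ⟨h1, h1⟩

theorem add_inv_ne_two {a : ℂ} (h0 : a ≠ 0) (h1 : a ≠ 1) (h2 : a ≠ -1) :
    a + a⁻¹ ≠ 2 ∧ a + a⁻¹ ≠ -2 := by
  constructor
  · intro h
    field_simp at h
    have h3 : (a - 1) ^ 2 = 0 := by linear_combination h
    exact h1 (sub_eq_zero.mp (pow_eq_zero_iff two_ne_zero |>.mp h3))
  · intro h
    field_simp at h
    have h3 : (a + 1) ^ 2 = 0 := by linear_combination h
    exact h2 (eq_neg_of_add_eq_zero_left (pow_eq_zero_iff two_ne_zero |>.mp h3))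

theorem FramedLocalSystem.trace_partialProd_one (A : FramedLocalSystem c) :
    (A.partialProd 1).val.trace = c 0 + (c 0)⁻¹ := by
  have h := A.partialProd_succ 0
  rw [Fin.val_zero, zero_add, partialProd_zero, one_mul] at h
  rw [h, A.trace_mat]

theorem FramedLocalSystem.trace_partialProd_last (A : FramedLocalSystem c) :
    (A.partialProd (n + 2)).val.trace = c (Fin.last _) + (c (Fin.last _))⁻¹ := by
  have h := A.partialProd_succ (Fin.last _)
  rw [Fin.val_last, partialProd_all] at h
  rw [← A.trace_mat, eq_inv_of_mul_eq_one_left h.symm, Matrix.SpecialLinearGroup.SL2_inv_expl,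
    Matrix.trace_fin_two, Matrix.trace_fin_two]
  simp [add_comm]

/-- Away from the loci where some `ρ_q` has monodromy of trace `±2`, all boundary circles of the
pairs of pants have monodromy with distinct eigenvalues: for the extreme ones this is a condition
on the conjugacy classes. -/
theorem FramedLocalSystem.partialProd_mem_traceNeTwo (hc : ∀ i, c i ≠ 0 ∧ c i ≠ 1 ∧ c i ≠ -1)
    (A : FramedLocalSystem c) (h : ∀ q : Fin n, ¬A.IsBad q) {j : ℕ} (hj1 : 1 ≤ j)
    (hj2 : j ≤ n + 2) : A.partialProd j ∈ traceNeTwo := by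
  rw [mem_traceNeTwo_iff]
  rcases hj1.eq_or_lt with rfl | hj1
  · rw [trace_partialProd_one]
    exact add_inv_ne_two (hc _).1 (hc _).2.1 (hc _).2.2
  rcases hj2.eq_or_lt with rfl | hj2
  · rw [trace_partialProd_last]
    exact add_inv_ne_two (hc _).1 (hc _).2.1 (hc _).2.2
  obtain ⟨q, rfl⟩ := Nat.exists_eq_add_of_le' hj1
  have h1 := h ⟨q, by omega⟩
  rw [isBad_castAdd, not_not] at h1
  exact h1

/-- The complement of the open stratum is filtered by pieces of the strata that have an affine
line factor. -/
theorem closedFiltration_compl_mainStratum (hgen : VeryGeneric c)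
    (hc : ∀ i, c i ≠ 0 ∧ c i ≠ 1 ∧ c i ≠ -1) :
    ClosedFiltration (fun Z => (∃ j : Fin (n + (n + 1)), Z ⊆ (firstBadDatum n j).stratum c) ∧
      IsProductWithAffineLine Z) (mainStratum c)ᶜ := by
  obtain ⟨D, hDdef⟩ : ∃ D : ℕ → Set (ModuliSpace c),
    D = fun j => locus fun A => A.IsBad j := ⟨_, rfl⟩
  have hD : ∀ j, IsClosed (D j) := fun j => hDdef ▸ isClosed_locus_isBad hc j
  have hmk : ∀ A j, mk A ∈ D j ↔ A.IsBad j := fun A j => by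
    rw [hDdef]
    exact mk_mem_locus (isInvariant_isBad hc j)
  have hstr : ∀ j < n + (n + 1), ∀ z, z ∈ (firstBadDatum n j).stratum c ↔
      z ∈ D j ∧ ∀ i < j, z ∉ D i := fun j hj z => by
    rw [hDdef]
    exact mem_stratum_firstBadDatum hc hj z
  obtain ⟨P, hPdef⟩ : ∃ P : Set (ModuliSpace c) → Prop, P = fun Z =>
    (∃ j : Fin (n + (n + 1)), Z ⊆ (firstBadDatum n j).stratum c) ∧
      IsProductWithAffineLine Z := ⟨_, rfl⟩
  have hP : ∀ j < n + (n + 1), ∀ Z ⊆ D j \ {z | ∃ i < j, z ∈ D i}, IsProductWithAffineLine Z →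
      P Z := by
    intro j hj Z hZ h
    rw [hPdef]
    exact ⟨⟨⟨j, hj⟩, fun z hz => (hstr j hj z).mpr
      ⟨(hZ hz).1, fun i hi hzi => (hZ hz).2 ⟨i, hi, hzi⟩⟩⟩, h⟩
  rw [← hPdef]
  have hcompl : (mainStratum c)ᶜ = {z | ∃ i < n + (n + 1), z ∈ D i} := by
    rw [mainStratum_eq hc, hDdef]
    ext z
    show (¬∀ i < n + (n + 1), z ∉ _) ↔ ∃ i < n + (n + 1), z ∈ _
    push Not
    rfl
  rw [hcompl]
  have hsucc : ∀ j, {z | ∃ i < j + 1, z ∈ D i} = {z | ∃ i < j, z ∈ D i} ∪ D j := fun j => by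
    ext z
    exact Nat.exists_lt_succ_right
  have key : ∀ j ≤ n + (n + 1), ClosedFiltration P {z | ∃ i < j, z ∈ D i} := by
    intro j
    induction j with
    | zero =>
      intro _
      have h : {z | ∃ i < 0, z ∈ D i} = ∅ := by
        ext z
        simp
      rw [h]
      exact ClosedFiltration.empty
    | succ j ih =>
      intro hj
      have hF := ih (by omega)
      have hPj := hP j (by omega)
      rw [hsucc j]
      by_cases hjn : j < n
      · have hleft : ∀ i ≤ j, ∀ A B : FramedLocalSystem c,
            (∀ l : Fin (n + 3), l < j + 2 → B.mat l = A.mat l) → mk B ∈ D i → mk A ∈ D i := by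
          intro i hi A B h hB
          rw [hmk] at hB ⊢
          rw [isBad_castAdd _ ⟨i, by omega⟩] at hB ⊢
          have h1 : B.partialProd (i + 2) = A.partialProd (i + 2) :=
            partialProd_congr (by omega) fun l hl => h l (by omega)
          rwa [← h1]
        have hDj : D j = (locus fun A => (A.partialProd (j + 2)).val.trace = 2 * 1) ∪
            locus fun A => (A.partialProd (j + 2)).val.trace = 2 * (-1) := by
          have h1 : ∀ A : FramedLocalSystem c, A.IsBad j ↔
              (A.partialProd (j + 2)).val.trace = 2 * 1 ∨
                (A.partialProd (j + 2)).val.trace = 2 * (-1) := fun A => by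
            rw [mul_one, mul_neg_one, ← not_mem_traceNeTwo_iff]
            exact A.isBad_castAdd ⟨j, hjn⟩
          rw [hDdef]
          simp only [h1, locus]
          rw [← Set.image_union]
          rfl
        have hinv : ∀ e : ℂ,
            IsInvariant fun A : FramedLocalSystem c => (A.partialProd (j + 2)).val.trace = e :=
          fun e A B h hA =>
            ((IsEquivariantRegular.partialProd (by omega)).trace_eq h).symm.trans hA
        have hFleft : ∀ A B : FramedLocalSystem c,
            (∀ l : Fin (n + 3), l < j + 2 → B.mat l = A.mat l) →
            mk B ∈ {z | ∃ i < j, z ∈ D i} → mk A ∈ {z | ∃ i < j, z ∈ D i} := by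
          rintro A B h ⟨i, hi, hB⟩
          exact ⟨i, hi, hleft i hi.le A B h hB⟩
        have hF₁ := hF.union_locus_trace_eq hgen hc (i := j + 2) (by omega) (by omega) hFleft
          (Or.inl rfl) fun Z hZ => hPj Z fun z hz =>
            ⟨hDj ▸ Or.inl (hZ hz).1, (hZ hz).2⟩
        have hF₂ := hF₁.union_locus_trace_eq hgen hc (i := j + 2) (by omega) (by omega)
          (fun A B h hB => ?_) (Or.inr rfl) fun Z hZ => hPj Z fun z hz =>
            ⟨hDj ▸ Or.inr (hZ hz).1, fun h => (hZ hz).2 (Or.inl h)⟩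
        · rwa [Set.union_assoc, ← hDj] at hF₂
        · rcases hB with hB | hB
          · exact Or.inl (hFleft A B h hB)
          · right
            rw [mk_mem_locus (hinv _)] at hB ⊢
            rwa [← partialProd_congr (by omega) h]
      · obtain ⟨p, hp⟩ := Nat.exists_eq_add_of_le (not_lt.mp hjn)
        obtain ⟨p, rfl⟩ : ∃ p' : Fin (n + 1), (p' : ℕ) = p := ⟨⟨p, by omega⟩, rfl⟩
        have hDp : ∀ A, mk A ∈ D j ↔ lineDefect (A.mat p.succ.castSucc).val
            (c p.succ.castSucc)⁻¹ (A.partialProd (p + 1)).val = 0 := fun A => by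
          rw [hmk, hp, isBad_natAdd, isUnstable_iff hc]
        have hgood : ∀ A, mk A ∈ D j \ {z | ∃ i < j, z ∈ D i} → ∀ q : Fin n, ¬A.IsBad q :=
          fun A hA q hq => hA.2 ⟨q, by omega, (hmk A q).mpr hq⟩
        refine hF.union_of_unstable hgen hc (hD j) hPj (a := p.succ.castSucc)
          (fun A hA => (hDp A).mp hA.1)
          (fun A hA => A.partialProd_mem_traceNeTwo hc (hgood A hA)
            (Nat.le_add_left 1 p) (Nat.succ_le_succ p.is_lt.le))
          (fun A hA => A.partialProd_mem_traceNeTwo hc (hgood A hA)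
            (Nat.le_add_left 1 _) (Nat.succ_le_succ p.is_lt)) ?_
        intro A B g hA h1 h2 h3
        refine ⟨(hDp B).mpr h3, ?_⟩
        rintro ⟨i, hi, hB⟩
        refine hA.2 ⟨i, hi, (hmk A i).mpr ?_⟩
        rcases (hmk B i).mp hB with ⟨q, rfl, hq⟩ | ⟨p', rfl, hp'⟩
        · rw [isBad_castAdd, not_mem_traceNeTwo_iff, ← h2 _ (by omega), ← not_mem_traceNeTwo_iff]
          exact hq
        · have hlt : (p' : ℕ) < p := by omega
          rw [isBad_natAdd]
          rw [isUnstable_iff hc] at hp' ⊢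
          have e1 : B.mat p'.succ.castSucc = g * A.mat p'.succ.castSucc * g⁻¹ :=
            h1 _ (Fin.lt_def.mpr (Nat.succ_lt_succ hlt))
          have e2 : B.partialProd (p' + 1) = g * A.partialProd (p' + 1) * g⁻¹ :=
            prod_take_ofFn_conj (M := A.mat) (M' := B.mat) g (Nat.zero_le (p' + 1)) (by omega)
              (by rw [List.take_zero, List.take_zero, List.prod_nil, mul_one, mul_inv_cancel])
              fun l _ hl => h1 l (Fin.lt_def.mpr (hl.trans (Nat.succ_lt_succ hlt)))
          rw [e1, e2] at hp'
          exact (lineDefect_conj_eq_zero_iff _ _ _ _).mp hp'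
  exact key _ le_rfl

end Strata

theorem mainTheorem10 (n : ℕ) (c : Fin (n + 3) → ℂ)
    (hc : ∀ i, c i ≠ 0 ∧ c i ≠ 1 ∧ c i ≠ -1) (hgen : VeryGeneric c) :
    ∃ (N : ℕ) (α : Fin N → StratumDatum n),
      IsOrderedStratification (mainStratum c) (fun j => (α j).stratum c) ∧
      ∃ (m : ℕ) (Z : Fin m → Set (ModuliSpace c)) (s : Fin m → Fin N),
        IsOrderedStratification (mainStratum c) Z ∧
        (∀ a, Z a ⊆ (α (s a)).stratum c) ∧
        ∀ a, IsProductWithAffineLine (Z a) := by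
  refine ⟨n + (n + 1), fun j => firstBadDatum n j,
    isOrderedStratification_of_closed (isClosed_locus_isBad hc) (mainStratum_eq hc)
      fun j => mem_stratum_firstBadDatum hc j.2, ?_⟩
  obtain ⟨m, Z, hZ, hP⟩ :=
    (closedFiltration_compl_mainStratum hgen hc).exists_isOrderedStratification
  choose s hs using fun a => (hP a).1
  exact ⟨m, Z, s, hZ, hs, fun a => (hP a).2⟩
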